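/- Fix countably infinite sets of concept names, role names and individual names (all identified with $\mathbb N$). Concepts of $\mathcal{ALCQ}(\circ)$ are built by $$C,D ::= A \mid \top \mid \bot \mid \neg C \mid C\sqcap D \mid C\sqcup D \mid \forall R.C \mid \exists R.C \mid \exists^{\geq n}R \mid \exists^{\leq n}R \mid \exists^{\geq n}R.C \mid \exists^{\leq n}R.C ,\qquad R ::= P \mid R\circ R,$$ where $A$ is a concept name, $P$ a role name and $n\in\mathbb N$, with the usual semantics over interpretations with non-empty domain. $C$ is satisfiable if $C^{\mathcal I}\neq\emptyset$ for some interpretation $\mathcal I$, and $D$ subsumes $C$ if $C^{\mathcal I}\subseteq D^{\mathcal I}$ for all $\mathcal I$. A concept is in normal form if it is built from $\top$, $\bot$, $A$, $\neg A$ by $\sqcap$, $\sqcup$ and qualified number restrictions. Every concept $C$ is transformed into an equivalent one $\mathrm{nnf}(C)$ in normal form by pushing negations inwards ($\neg\exists^{\leq n}R.C = \exists^{\geq n+1}R.C$; $\neg\exists^{\geq n}R.C=\exists^{\leq n-1}R.C$, which is $\bot$ if $n=0$) and by $\exists R.C=\exists^{\geq1}R.C$, $\forall R.C=\exists^{\leq0}R.\neg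 C$, $\exists^{\bowtie n}R=\exists^{\bowtie n}R.\top$, where $\bowtie$ is $\geq$ or $\leq$. Write $\sim C$ for the normal form of $\neg C$. An ABox is a finite set $\mathcal A$ of assertions $C(x)$ ($C$ in normal form), $P(x,y)$ and $x\neq y$ (symmetric) on individual names. An $(R_1\circ\dots\circ R_m)$-successor of $x$ in $\mathcal A$ is a $y$ for which there are $x=y_1,y_2,\dots,y_{m+1}=y$ with $R_k(y_k,y_{k+1})\in\mathcal A$ for $1\le k\le m$. $\mathcal A$ contains a clash if for some $x$: $\bot(x)\in\mathcal A$; or $\{A(x),\neg A(x)\}\subseteq\mathcal A$ for a concept name $A$; or $(\exists^{\leq n}R.C)(x)\in\mathcal A$ and $x$ has more than $n$ $R$-successors $y$ with $C(y)\in\mathcal A$ that are pairwise asserted to be different in $\mathcal A$. The completion rules are: * $\sqcap$: if $(C_1\sqcap C_2)(x)\in\mathcal A$ and $\{C_1(x),C_2(x)\}\not\subseteq\mathcal A$, add $C_1(x)$ and $C_2(x)$. * $\sqcup$: if $(C_1\sqcup C_2)(x)\in\mathcal A$ and $\{C_1(x),C_2(x)\}\cap\mathcal A=\emptyset$, add $C_1(x)$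 or add $C_2(x)$. * $\geq$: if $(\exists^{\geq n}R_1\circ\dots\circ R_m.C)(x)\in\mathcal A$, and the largest sets of $(R_1\circ\dots\circ R_m)$-successors $y$ of $x$ with $C(y)\in\mathcal A$ that are pairwise asserted to be different have $p<n$ elements, take such a set $\{y_1,\dots,y_p\}$ and fresh names $z_{i2},\dots,z_{im},z_i$ ($1\le i\le n-p$), all different, and add $R_1(x,z_{i2}),R_2(z_{i2},z_{i3}),\dots,R_m(z_{im},z_i)$, $C(z_i)$, $z_i\neq z_j$ for $i<j$, and $y_l\neq z_i$, for all $i$ and $l$. * $\leq$: if $(\exists^{\leq n}R.C)(x)\in\mathcal A$ and $x$ has $p>n$ $R$-successors $y_1,\dots,y_p$ with $C(y_i)\in\mathcal A$, not all pairwise asserted to be different, replace $y_i$ by $y_j$ everywhere in $\mathcal A$ for some pair of two such individuals with $(y_i\neq y_j)\notin\mathcal A$. * choose: if $(\exists^{\geq n}R.C)(x)\in\mathcal A$ or $(\exists^{\leq n}R.C)(x)\in\mathcal A$, and $y$ is an $R$-successor of $x$ with $\{C(y),\sim C(y)\}\cap\mathcal A=\emptyset$, add $C(y)$ or add $\sim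 C(y)$. An ABox is complete if no rule is applicable. On input $C_0$ in normal form, the tableau algorithm starts from $\{C_0(x_0)\}$ and applies rules as long as one is applicable; the result of the $\sqcup$-, $\leq$- and choose-rules is chosen nondeterministically among the stated ones. It accepts $C_0$ if some run produces a complete and clash-free ABox. **Corollary.** Concept satisfiability and subsumption for $\mathcal{ALCQ}(\circ)$ are decidable, and the tableau algorithm is a decision procedure for them: 1. the set of satisfiable concepts and the set of pairs $(C,D)$ such that $D$ subsumes $C$ are computable (with respect to a standard Gödel numbering of concepts); 2. (termination) for every $C_0$ in normal form there is no infinite sequence of rule applications starting from $\{C_0(x_0)\}$; 3. (soundness) if some sequence of rule applications leads from $\{\mathrm{nnf}(C)(x_0)\}$ to a complete and clash-free ABox, then $C$ is satisfiable; 4. (soundness and completeness) for every strategy that selects an applicable rule instance in each non-complete ABox, the algorithm that follows this strategy accepts $\mathrm{nnf}(C)$ if and only if $C$ is satisfiable, and it does not accept $\mathrm{nnf}(C\sqcap\neg D)$ if and only if $D$ subsumes $C$. -/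

import Mathlib

universe u

namespace DL

/-! ### Syntax -/

/-- Role expressions built from role names (natural numbers) by composition. -/
inductive Role : Type
  | atom (r : ℕ) : Role
  | comp (R S : Role) : Role

/-- Concept descriptions of `ALCQ(∘)`; concept names are natural numbers. -/
inductive Concept : Type
  | top : Concept
  | bot : Concept
  | atom (a : ℕ) : Concept
  | not (C : Concept) : Concept
  | and (C D : Concept) : Concept
  | or (C D : Concept) : Concept
  | all (R : Role) (C : Concept) : Concept
  | ex (R : Role) (C : Concept) : Concept
  /-- unqualified number restriction, at least `n` -/
  | ge (n : ℕ) (R : Role) : Concept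
  /-- unqualified number restriction, at most `n` -/
  | le (n : ℕ) (R : Role) : Concept
  /-- qualified number restriction, at least `n` -/
  | geq (n : ℕ) (R : Role) (C : Concept) : Concept
  /-- qualified number restriction, at most `n` -/
  | leq (n : ℕ) (R : Role) (C : Concept) : Concept

/-! ### Semantics -/

/-- An interpretation with domain `Δ` (the domain is required to be non-empty where
interpretations are quantified over). -/
structure Interp (Δ : Type u) where
  concept : ℕ → Set Δ
  role : ℕ → Δ → Δ → Prop

def Role.interp {Δ : Type u} (I : Interp Δ) : Role → Δ → Δ → Prop
  | .atom r => I.role r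
  | .comp R S => fun i j => ∃ k, R.interp I i k ∧ S.interp I k j

def Concept.interp {Δ : Type u} (I : Interp Δ) : Concept → Set Δ
  | .top => Set.univ
  | .bot => ∅
  | .atom a => I.concept a
  | .not C => (C.interp I)ᶜ
  | .and C D => C.interp I ∩ D.interp I
  | .or C D => C.interp I ∪ D.interp I
  | .all R C => {i | ∀ j, R.interp I i j → j ∈ C.interp I}
  | .ex R C => {i | ∃ j, R.interp I i j ∧ j ∈ C.interp I}
  | .ge n R => {i | (n : ℕ∞) ≤ {j | R.interp I i j}.encard}
  | .le n R => {i | {j | R.interp I i j}.encard ≤ (n : ℕ∞)}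
  | .geq n R C => {i | (n : ℕ∞) ≤ {j | R.interp I i j ∧ j ∈ C.interp I}.encard}
  | .leq n R C => {i | {j | R.interp I i j ∧ j ∈ C.interp I}.encard ≤ (n : ℕ∞)}

def Concept.Satisfiable (C : Concept) : Prop :=
  ∃ (Δ : Type u) (_ : Nonempty Δ) (I : Interp Δ), (C.interp I).Nonempty

/-- `C.SubsumedBy D`: the concept `D` subsumes the concept `C`. -/
def Concept.SubsumedBy (C D : Concept) : Prop :=
  ∀ (Δ : Type u) (_ : Nonempty Δ) (I : Interp Δ), C.interp I ⊆ D.interp I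

/-! ### Gödel numbering of concepts -/

def Role.toNat : Role → ℕ
  | .atom r => 2 * r
  | .comp R S => 2 * Nat.pair R.toNat S.toNat + 1

def Role.ofNat (n : ℕ) : Role :=
  if h : n % 2 = 0 then .atom (n / 2)
  else
    have h1 : (Nat.unpair (n / 2)).1 < n :=
      lt_of_le_of_lt (Nat.unpair_left_le _) (by omega)
    have h2 : (Nat.unpair (n / 2)).2 < n :=
      lt_of_le_of_lt (Nat.unpair_right_le _) (by omega)
    .comp (Role.ofNat (Nat.unpair (n / 2)).1) (Role.ofNat (Nat.unpair (n / 2)).2)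
termination_by n

theorem Role.ofNat_toNat (R : Role) : Role.ofNat R.toNat = R := by
  induction R with
  | atom r => rw [Role.toNat, Role.ofNat]; simp
  | comp R S hR hS =>
    rw [Role.toNat, Role.ofNat]
    have h : (2 * Nat.pair R.toNat S.toNat + 1) / 2 = Nat.pair R.toNat S.toNat := by omega
    simp [h, hR, hS]

theorem Role.toNat_ofNat (n : ℕ) : (Role.ofNat n).toNat = n := by
  induction n using Nat.strong_induction_on with
  | _ n ih =>
    rw [Role.ofNat]
    split_ifs with h
    · rw [Role.toNat]; omega
    · have h1 : (Nat.unpair (n / 2)).1 < n :=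
        lt_of_le_of_lt (Nat.unpair_left_le _) (by omega)
      have h2 : (Nat.unpair (n / 2)).2 < n :=
        lt_of_le_of_lt (Nat.unpair_right_le _) (by omega)
      simp only [Role.toNat, ih _ h1, ih _ h2, Nat.pair_unpair]
      omega

def Concept.toNat : Concept → ℕ
  | .top => 0
  | .bot => 1
  | .atom a => 10 * a + 2
  | .not C => 10 * C.toNat + 3
  | .and C D => 10 * Nat.pair C.toNat D.toNat + 4
  | .or C D => 10 * Nat.pair C.toNat D.toNat + 5
  | .all R C => 10 * Nat.pair R.toNat C.toNat + 6
  | .ex R C => 10 * Nat.pair R.toNat C.toNat + 7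
  | .ge n R => 10 * Nat.pair n R.toNat + 8
  | .le n R => 10 * Nat.pair n R.toNat + 9
  | .geq n R C => 10 * Nat.pair n (Nat.pair R.toNat C.toNat) + 10
  | .leq n R C => 10 * Nat.pair n (Nat.pair R.toNat C.toNat) + 11

def Concept.ofNat : ℕ → Concept
  | 0 => .top
  | 1 => .bot
  | n + 2 =>
    have hk : n / 10 < n + 2 := by omega
    have h1 : (Nat.unpair (n / 10)).1 < n + 2 := lt_of_le_of_lt (Nat.unpair_left_le _) hk
    have h2 : (Nat.unpair (n / 10)).2 < n + 2 := lt_of_le_of_lt (Nat.unpair_right_le _) hk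
    have h3 : (Nat.unpair (Nat.unpair (n / 10)).2).2 < n + 2 :=
      lt_of_le_of_lt (Nat.unpair_right_le _) h2
    match n % 10 with
    | 0 => .atom (n / 10)
    | 1 => .not (Concept.ofNat (n / 10))
    | 2 => .and (Concept.ofNat (Nat.unpair (n / 10)).1) (Concept.ofNat (Nat.unpair (n / 10)).2)
    | 3 => .or (Concept.ofNat (Nat.unpair (n / 10)).1) (Concept.ofNat (Nat.unpair (n / 10)).2)
    | 4 => .all (Role.ofNat (Nat.unpair (n / 10)).1) (Concept.ofNat (Nat.unpair (n / 10)).2)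
    | 5 => .ex (Role.ofNat (Nat.unpair (n / 10)).1) (Concept.ofNat (Nat.unpair (n / 10)).2)
    | 6 => .ge (Nat.unpair (n / 10)).1 (Role.ofNat (Nat.unpair (n / 10)).2)
    | 7 => .le (Nat.unpair (n / 10)).1 (Role.ofNat (Nat.unpair (n / 10)).2)
    | 8 => .geq (Nat.unpair (n / 10)).1 (Role.ofNat (Nat.unpair (Nat.unpair (n / 10)).2).1)
        (Concept.ofNat (Nat.unpair (Nat.unpair (n / 10)).2).2)
    | _ => .leq (Nat.unpair (n / 10)).1 (Role.ofNat (Nat.unpair (Nat.unpair (n / 10)).2).1)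
        (Concept.ofNat (Nat.unpair (Nat.unpair (n / 10)).2).2)
termination_by n => n
decreasing_by all_goals assumption

theorem Concept.ofNat_toNat (C : Concept) : Concept.ofNat C.toNat = C := by
  have hd : ∀ k t : ℕ, t < 10 → (10 * k + t) / 10 = k := by omega
  have hm : ∀ k t : ℕ, t < 10 → (10 * k + t) % 10 = t := by omega
  induction C with
  | top => rw [Concept.toNat, Concept.ofNat]
  | bot => rw [Concept.toNat, Concept.ofNat]
  | atom a =>
    rw [Concept.toNat, Concept.ofNat]; simp
  | not C hC =>
    rw [Concept.toNat, Concept.ofNat]; simp [hd _ 1, hm _ 1, hC]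
  | and C D hC hD =>
    rw [Concept.toNat, Concept.ofNat]; simp [hd _ 2, hm _ 2, hC, hD]
  | or C D hC hD =>
    rw [Concept.toNat, Concept.ofNat]; simp [hd _ 3, hm _ 3, hC, hD]
  | all R C hC =>
    rw [Concept.toNat, Concept.ofNat]; simp [hd _ 4, hm _ 4, hC, Role.ofNat_toNat]
  | ex R C hC =>
    rw [Concept.toNat, Concept.ofNat]; simp [hd _ 5, hm _ 5, hC, Role.ofNat_toNat]
  | ge n R =>
    rw [Concept.toNat, Concept.ofNat]; simp [hd _ 6, hm _ 6, Role.ofNat_toNat]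
  | le n R =>
    rw [Concept.toNat, Concept.ofNat]; simp [hd _ 7, hm _ 7, Role.ofNat_toNat]
  | geq n R C hC =>
    rw [Concept.toNat, Concept.ofNat]; simp [hd _ 8, hm _ 8, hC, Role.ofNat_toNat]
  | leq n R C hC =>
    rw [Concept.toNat, Concept.ofNat]; simp [hd _ 9, hm _ 9, hC, Role.ofNat_toNat]

theorem Concept.toNat_ofNat (n : ℕ) : (Concept.ofNat n).toNat = n := by
  induction n using Nat.strong_induction_on with
  | _ n ih =>
    match n, ih with
    | 0, _ => rw [Concept.ofNat, Concept.toNat]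
    | 1, _ => rw [Concept.ofNat, Concept.toNat]
    | n + 2, ih =>
      have hk : n / 10 < n + 2 := by omega
      have h1 : (Nat.unpair (n / 10)).1 < n + 2 := lt_of_le_of_lt (Nat.unpair_left_le _) hk
      have h2 : (Nat.unpair (n / 10)).2 < n + 2 := lt_of_le_of_lt (Nat.unpair_right_le _) hk
      have h3 : (Nat.unpair (Nat.unpair (n / 10)).2).2 < n + 2 :=
        lt_of_le_of_lt (Nat.unpair_right_le _) h2
      have hr : n % 10 = 0 ∨ n % 10 = 1 ∨ n % 10 = 2 ∨ n % 10 = 3 ∨ n % 10 = 4 ∨ n % 10 = 5 ∨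
          n % 10 = 6 ∨ n % 10 = 7 ∨ n % 10 = 8 ∨ n % 10 = 9 := by omega
      rw [Concept.ofNat]
      rcases hr with h | h | h | h | h | h | h | h | h | h <;>
        simp only [h, Concept.toNat, ih _ hk, ih _ h1, ih _ h2, ih _ h3, Role.toNat_ofNat,
          Nat.pair_unpair] <;> omega

instance : Denumerable Concept :=
  Denumerable.mk' ⟨Concept.toNat, Concept.ofNat, Concept.ofNat_toNat, Concept.toNat_ofNat⟩

instance : Primcodable Concept := Primcodable.ofDenumerable Concept

/-! ### Negation normal form without value restrictions -/

/-- Concepts in negation normal form in which value, existential and unqualified number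
restrictions have been replaced by qualified number restrictions. -/
inductive NNF : Type
  | top : NNF
  | bot : NNF
  | atom (a : ℕ) : NNF
  | natom (a : ℕ) : NNF
  | and (C D : NNF) : NNF
  | or (C D : NNF) : NNF
  | geq (n : ℕ) (R : Role) (C : NNF) : NNF
  | leq (n : ℕ) (R : Role) (C : NNF) : NNF

/-- `C.neg` is the normal form `∼ C` of the negation of `C`. -/
def NNF.neg : NNF → NNF
  | .top => .bot
  | .bot => .top
  | .atom a => .natom a
  | .natom a => .atom a
  | .and C D => .or C.neg D.neg
  | .or C D => .and C.neg D.neg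
  | .geq 0 _ _ => .bot
  | .geq (n + 1) R C => .leq n R C
  | .leq n R C => .geq (n + 1) R C

def Concept.nnf : Concept → NNF
  | .top => .top
  | .bot => .bot
  | .atom a => .atom a
  | .not C => C.nnf.neg
  | .and C D => .and C.nnf D.nnf
  | .or C D => .or C.nnf D.nnf
  | .all R C => .leq 0 R C.nnf.neg
  | .ex R C => .geq 1 R C.nnf
  | .ge n R => .geq n R .top
  | .le n R => .leq n R .top
  | .geq n R C => .geq n R C.nnf
  | .leq n R C => .leq n R C.nnf

/-! ### ABoxes -/

/-- Assertions about individual names, which are natural numbers. Inequality assertions are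
symmetric: they carry an unordered pair. -/
inductive Assertion : Type
  | concept (C : NNF) (x : ℕ) : Assertion
  | role (r : ℕ) (x y : ℕ) : Assertion
  | neq (p : Sym2 ℕ) : Assertion

noncomputable instance : DecidableEq Assertion := Classical.decEq _

abbrev ABox : Type := Finset Assertion

/-- The individual name `a` occurs in the assertion. -/
def Assertion.Mentions (a : ℕ) : Assertion → Prop
  | .concept _ x => a = x
  | .role _ x y => a = x ∨ a = y
  | .neq p => a ∈ p

/-- Replace every occurrence of the name `a` by `b`. -/
def Assertion.replace (a b : ℕ) : Assertion → Assertion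
  | .concept C x => .concept C (if x = a then b else x)
  | .role r x y => .role r (if x = a then b else x) (if y = a then b else y)
  | .neq p => .neq (p.map fun x => if x = a then b else x)

/-- The (non-empty) list `[R₁, …, Rₘ]` of role names of a composition `R₁ ∘ ⋯ ∘ Rₘ`. -/
def Role.chain : Role → List ℕ
  | .atom r => [r]
  | .comp R S => R.chain ++ S.chain

/-- `y` is reached from `x` in the ABox `A` along a list of role names. -/
def ABox.Reaches (A : ABox) : List ℕ → ℕ → ℕ → Prop
  | [], x, y => x = y
  | r :: rs, x, y => ∃ z, Assertion.role r x z ∈ A ∧ ABox.Reaches A rs z y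

/-- `y` is an `R`-successor of `x` in `A`. -/
def ABox.IsSucc (A : ABox) (R : Role) (x y : ℕ) : Prop := ABox.Reaches A R.chain x y

/-- `Y` is a set of `R`-successors of `x` that are asserted to be instances of `C`. -/
def ABox.Instances (A : ABox) (R : Role) (C : NNF) (x : ℕ) (Y : Finset ℕ) : Prop :=
  ∀ y ∈ Y, ABox.IsSucc A R x y ∧ Assertion.concept C y ∈ A

/-- Moreover, the elements of `Y` are asserted to be pairwise different. -/
def ABox.DistinctInstances (A : ABox) (R : Role) (C : NNF) (x : ℕ) (Y : Finset ℕ) : Prop :=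
  ABox.Instances A R C x Y ∧
    ∀ y ∈ Y, ∀ y' ∈ Y, y ≠ y' → Assertion.neq s(y, y') ∈ A

inductive ABox.Clash (A : ABox) : Prop
  | bot (x : ℕ) (h : Assertion.concept .bot x ∈ A) : ABox.Clash A
  | atom (a x : ℕ) (h : Assertion.concept (.atom a) x ∈ A)
      (h' : Assertion.concept (.natom a) x ∈ A) : ABox.Clash A
  | leq (n : ℕ) (R : Role) (C : NNF) (x : ℕ) (Y : Finset ℕ)
      (h : Assertion.concept (.leq n R C) x ∈ A)
      (hY : ABox.DistinctInstances A R C x Y) (hn : n < Y.card) : ABox.Clash A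

/-! ### Completion rules -/

/-- The `j`-th individual on the path `x, z₁, …, zₘ`. -/
def node {m : ℕ} (x : ℕ) (z : Fin m → ℕ) (j : Fin (m + 1)) : ℕ :=
  (Fin.cons x z : Fin (m + 1) → ℕ) j

/-- The result of adding to `A`, for each `i < k`, a path from `x` to a new `R`-successor
through `z i`, whose end is an instance of `C`; the ends are asserted to be different
from one another and from the elements of `Y`. -/
noncomputable def ABox.addSuccessors (A : ABox) (R : Role) (C : NNF) (x : ℕ) (Y : Finset ℕ)
    {k : ℕ} (z : Fin k → Fin R.chain.length → ℕ) : ABox :=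
  A
  ∪ Finset.univ.image (fun p : Fin k × Fin R.chain.length =>
      Assertion.role (R.chain.get p.2) (node x (z p.1) p.2.castSucc) (node x (z p.1) p.2.succ))
  ∪ Finset.univ.image (fun i : Fin k => Assertion.concept C (node x (z i) (Fin.last _)))
  ∪ ((Finset.univ : Finset (Fin k × Fin k)).filter (fun p => p.1 < p.2)).image (fun p =>
      Assertion.neq s(node x (z p.1) (Fin.last _), node x (z p.2) (Fin.last _)))
  ∪ (Y ×ˢ (Finset.univ : Finset (Fin k))).image (fun p =>
      Assertion.neq s(p.1, node x (z p.2) (Fin.last _)))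

/-- `ABox.Rule A S`: some completion rule is applicable to `A` in such a way that `S` is the set
of the possible results, among which the rule chooses nondeterministically. -/
inductive ABox.Rule (A : ABox) : Set ABox → Prop
  | and (C D : NNF) (x : ℕ)
      (h : Assertion.concept (.and C D) x ∈ A)
      (hn : ¬ ({Assertion.concept C x, Assertion.concept D x} : ABox) ⊆ A) :
      ABox.Rule A {A ∪ {Assertion.concept C x, Assertion.concept D x}}
  | or (C D : NNF) (x : ℕ)
      (h : Assertion.concept (.or C D) x ∈ A)
      (hC : Assertion.concept C x ∉ A) (hD : Assertion.concept D x ∉ A) :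
      ABox.Rule A {A ∪ {Assertion.concept C x}, A ∪ {Assertion.concept D x}}
  /-- The largest sets of asserted-to-be-different `R`-successors of `x` that are instances
  of `C` have `Y.card < n` elements; `Y` is one of them and `z` consists of fresh names. -/
  | geq (n : ℕ) (R : Role) (C : NNF) (x : ℕ) (Y : Finset ℕ)
      (z : Fin (n - Y.card) → Fin R.chain.length → ℕ)
      (h : Assertion.concept (.geq n R C) x ∈ A)
      (hY : ABox.DistinctInstances A R C x Y)
      (hmax : ∀ Y' : Finset ℕ, ABox.DistinctInstances A R C x Y' → Y'.card ≤ Y.card)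
      (hn : Y.card < n)
      (hz : Function.Injective (Function.uncurry z))
      (hfresh : ∀ i j, ∀ a ∈ A, ¬ Assertion.Mentions (z i j) a) :
      ABox.Rule A {ABox.addSuccessors A R C x Y z}
  | leq (n : ℕ) (R : Role) (C : NNF) (x : ℕ) (Y : Finset ℕ)
      (h : Assertion.concept (.leq n R C) x ∈ A)
      (hY : ABox.Instances A R C x Y) (hn : n < Y.card)
      (hne : ∃ y ∈ Y, ∃ y' ∈ Y, y ≠ y' ∧ Assertion.neq s(y, y') ∉ A) :
      ABox.Rule A {A' | ∃ y ∈ Y, ∃ y' ∈ Y, y ≠ y' ∧ Assertion.neq s(y, y') ∉ A ∧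
        A' = A.image (Assertion.replace y y')}
  | choose (n : ℕ) (R : Role) (C : NNF) (x y : ℕ)
      (h : Assertion.concept (.geq n R C) x ∈ A ∨ Assertion.concept (.leq n R C) x ∈ A)
      (hy : ABox.IsSucc A R x y)
      (hC : Assertion.concept C y ∉ A) (hC' : Assertion.concept C.neg y ∉ A) :
      ABox.Rule A {A ∪ {Assertion.concept C y}, A ∪ {Assertion.concept C.neg y}}

/-- `A'` is obtained from `A` by one application of a completion rule. -/
def ABox.Step (A A' : ABox) : Prop := ∃ S, ABox.Rule A S ∧ A' ∈ S

/-- No completion rule is applicable. -/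
def ABox.Complete (A : ABox) : Prop := ∀ S, ¬ ABox.Rule A S

/-- The initial ABox `{C₀(x₀)}`, with `x₀ = 0`. -/
noncomputable def ABox.init (C₀ : NNF) : ABox := {Assertion.concept C₀ 0}

/-- A strategy selects an applicable rule instance for each ABox that is not complete. It does
not resolve the nondeterministic choice made by the rule. -/
def IsStrategy (σ : ABox → Set ABox) : Prop :=
  ∀ A, ¬ ABox.Complete A → ABox.Rule A (σ A)

/-- One step of the tableau algorithm that selects rules by `σ`. -/
def StepBy (σ : ABox → Set ABox) (A A' : ABox) : Prop := ¬ ABox.Complete A ∧ A' ∈ σ A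

/-- The nondeterministic tableau algorithm that selects rules by `σ` answers
"satisfiable" on `C₀`: some run ends in a complete and clash-free ABox. -/
def Accepts (σ : ABox → Set ABox) (C₀ : NNF) : Prop :=
  ∃ A, Relation.ReflTransGen (StepBy σ) (ABox.init C₀) A ∧ ABox.Complete A ∧ ¬ ABox.Clash A

end DL

/-!
The tableau algorithm is treated by its usual three properties; decidability is obtained separately
from a computable bound on the size of models.

*Soundness.* In a complete and clash-free ABox, the interpretation on the individual names in which
exactly the asserted atomic facts hold is a model of all concept assertions
(`ABox.Complete.mem_interp`). For `∃^{≤n}R.C` the choose-rule makes every successor in the extension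
of `C` an asserted instance, and more than `n` of them would allow the `≤`-rule or form a clash.

*Completeness.* Every rule applied to an ABox with a model has a result with a model
(`ABox.Holds.exists_mem_rule`), and ABoxes with a model are clash-free. Thus some run of each
strategy ends in a clash-free ABox, once all runs are known to be finite.

*Termination.* All role paths from the root to an individual have the same length, its level: the
`≤`-rule only identifies individuals reached from a common one by paths of the same length. Concepts
asserted at level `l` speak about the levels up to the depth of the input concept only. At each
individual, the `≥`-rule is applied at most once per concept, since asserted inequalities survive
identifications, and it creates individuals of higher levels only. The vector of the costs of the
levels therefore decreases lexicographically (`Invariant.step`).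

*Decidability.* Unravelling a model into levels and keeping, for each kept element, enough witnesses
for the role-successor counts (up to a threshold) of all concepts with smaller code yields a model
in which only a bounded number of elements matter (`Concept.Satisfiable.exists_small_model`). The
evaluation of concepts in such a model is described by two bit tables of bounded size, so that
satisfiability amounts to a primitive recursive search for tables that obey the semantic clauses
(`Concept.satisfiable_iff_hasTable`).
-/

namespace DL

/-! ### Semantics of normal forms -/

/-- The extension of a concept in normal form. -/
def NNF.interp {Δ : Type u} (I : Interp Δ) : NNF → Set Δ
  | .top => Set.univ
  | .bot => ∅
  | .atom a => I.concept a
  | .natom a => (I.concept a)ᶜ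
  | .and C D => C.interp I ∩ D.interp I
  | .or C D => C.interp I ∪ D.interp I
  | .geq n R C => {i | (n : ℕ∞) ≤ {j | R.interp I i j ∧ j ∈ C.interp I}.encard}
  | .leq n R C => {i | {j | R.interp I i j ∧ j ∈ C.interp I}.encard ≤ (n : ℕ∞)}

theorem NNF.interp_neg {Δ : Type u} (I : Interp Δ) (C : NNF) :
    C.neg.interp I = (C.interp I)ᶜ := by
  induction C with
  | top => simp [NNF.neg, NNF.interp]
  | bot => simp [NNF.neg, NNF.interp]
  | atom a => simp [NNF.neg, NNF.interp]
  | natom a => simp [NNF.neg, NNF.interp]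
  | and C D hC hD => simp [NNF.neg, NNF.interp, hC, hD, Set.compl_inter]
  | or C D hC hD => simp [NNF.neg, NNF.interp, hC, hD, Set.compl_union]
  | geq n R C =>
    cases n with
    | zero => ext; simp [NNF.neg, NNF.interp]
    | succ n =>
      ext i
      simp only [NNF.neg, NNF.interp, Set.mem_ofPred_eq, Set.mem_compl_iff, not_le]
      push_cast
      exact (ENat.lt_add_one_iff (ENat.natCast_ne_top n)).symm
  | leq n R C =>
    ext i
    simp only [NNF.neg, NNF.interp, Set.mem_ofPred_eq, Set.mem_compl_iff, not_le]
    push_cast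
    exact ENat.add_one_le_iff (ENat.natCast_ne_top n)

theorem Concept.interp_nnf {Δ : Type u} (I : Interp Δ) (C : Concept) :
    C.nnf.interp I = C.interp I := by
  induction C with
  | top => rfl
  | bot => rfl
  | atom a => rfl
  | not C hC => simp [Concept.nnf, Concept.interp, NNF.interp_neg, hC]
  | and C D hC hD => simp [Concept.nnf, Concept.interp, NNF.interp, hC, hD]
  | or C D hC hD => simp [Concept.nnf, Concept.interp, NNF.interp, hC, hD]
  | all R C hC =>
    ext i
    simp only [Concept.nnf, Concept.interp, NNF.interp, NNF.interp_neg, hC, Nat.cast_zero,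
      nonpos_iff_eq_zero, Set.encard_eq_zero, Set.mem_ofPred_eq, Set.eq_empty_iff_forall_notMem,
      Set.mem_compl_iff, not_and, not_not]
  | ex R C hC =>
    ext i
    simp only [Concept.nnf, Concept.interp, NNF.interp, hC, Nat.cast_one,
      Set.one_le_encard_iff_nonempty, Set.mem_ofPred_eq]
    rfl
  | ge n R => simp [Concept.nnf, Concept.interp, NNF.interp]
  | le n R => simp [Concept.nnf, Concept.interp, NNF.interp]
  | geq n R C hC => simp [Concept.nnf, Concept.interp, NNF.interp, hC]
  | leq n R C hC => simp [Concept.nnf, Concept.interp, NNF.interp, hC]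

theorem Concept.subsumedBy_iff (C D : Concept) :
    C.SubsumedBy.{u} D ↔ ¬ (Concept.and C (.not D)).Satisfiable.{u} := by
  simp only [Concept.SubsumedBy, Concept.Satisfiable, Concept.interp, not_exists,
    Set.not_nonempty_iff_eq_empty, ← Set.sdiff_eq, Set.sdiff_eq_empty]

theorem Role.chain_ne_nil (R : Role) : R.chain ≠ [] := by
  induction R with
  | atom r => simp [Role.chain]
  | comp R S hR _ => simp [Role.chain, hR]

theorem Role.chain_length_pos (R : Role) : 0 < R.chain.length :=
  List.length_pos_iff.2 R.chain_ne_nil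

/-- `y` is reached from `x` in the interpretation `I` along a list of role names. -/
def Interp.Reaches {Δ : Type u} (I : Interp Δ) : List ℕ → Δ → Δ → Prop
  | [], x, y => x = y
  | r :: rs, x, y => ∃ z, I.role r x z ∧ I.Reaches rs z y

theorem Interp.reaches_append {Δ : Type u} (I : Interp Δ) (l l' : List ℕ) (x y : Δ) :
    I.Reaches (l ++ l') x y ↔ ∃ z, I.Reaches l x z ∧ I.Reaches l' z y := by
  induction l generalizing x with
  | nil => simp [Interp.Reaches]
  | cons r l ih =>
    simp only [List.cons_append, Interp.Reaches, ih]
    constructor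
    · rintro ⟨w, h, z, h', h''⟩
      exact ⟨z, ⟨w, h, h'⟩, h''⟩
    · rintro ⟨z, ⟨w, h, h'⟩, h''⟩
      exact ⟨w, h, z, h', h''⟩

theorem Role.interp_iff_reaches {Δ : Type u} (I : Interp Δ) (R : Role) (x y : Δ) :
    R.interp I x y ↔ I.Reaches R.chain x y := by
  induction R generalizing x y with
  | atom r => simp [Role.interp, Role.chain, Interp.Reaches]
  | comp R S hR hS => simp [Role.interp, Role.chain, Interp.reaches_append, hR, hS]

/-- The points on a path along the list `l`, indexed by positions. -/
theorem Interp.reaches_iff_exists_path {Δ : Type u} (I : Interp Δ) (l : List ℕ) (x y : Δ) :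
    I.Reaches l x y ↔ ∃ f : ℕ → Δ, f 0 = x ∧ f l.length = y ∧
      ∀ i (hi : i < l.length), I.role l[i] (f i) (f (i + 1)) := by
  induction l generalizing x with
  | nil => exact ⟨fun h => ⟨fun _ => x, rfl, h, by simp⟩, fun ⟨f, h, h', _⟩ => h.symm.trans h'⟩
  | cons r l ih =>
    constructor
    · rintro ⟨z, hz, h⟩
      obtain ⟨f, h0, h1, hf⟩ := (ih z).1 h
      refine ⟨fun i => Nat.casesOn i x f, rfl, h1, ?_⟩
      rintro (_ | i) hi
      · simpa [h0] using hz
      · exact hf i (by simpa using hi)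
    · rintro ⟨f, h0, h1, hf⟩
      refine ⟨f 1, h0 ▸ hf 0 (by simp), (ih _).2
        ⟨fun i => f (i + 1), rfl, h1, fun i hi => hf (i + 1) (by simpa using hi)⟩⟩

/-! ### Names occurring in an ABox -/

/-- The individual names that occur in an assertion. -/
noncomputable def Assertion.names : Assertion → Finset ℕ
  | .concept _ x => {x}
  | .role _ x y => {x, y}
  | .neq p => p.toFinset

theorem Assertion.mem_names {a : ℕ} {s : Assertion} : a ∈ s.names ↔ s.Mentions a := by
  cases s <;> simp [Assertion.names, Assertion.Mentions]

/-- The individual names that occur in an ABox. -/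
noncomputable def ABox.names (A : ABox) : Finset ℕ := A.biUnion Assertion.names

theorem ABox.mem_names {A : ABox} {a : ℕ} : a ∈ A.names ↔ ∃ s ∈ A, s.Mentions a := by
  simp [ABox.names, Assertion.mem_names]

theorem ABox.mem_names_of_concept {A : ABox} {C : NNF} {x : ℕ}
    (h : Assertion.concept C x ∈ A) : x ∈ A.names :=
  ABox.mem_names.2 ⟨_, h, rfl⟩

theorem ABox.DistinctInstances.subset_names {A : ABox} {R : Role} {C : NNF} {x : ℕ}
    {Y : Finset ℕ} (h : A.DistinctInstances R C x Y) : Y ⊆ A.names :=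
  fun y hy => ABox.mem_names_of_concept (h.1 y hy).2

/-- The interpretation whose elements are the individual names and in which
exactly the asserted atomic facts hold. -/
def ABox.toInterp (A : ABox) : Interp ℕ where
  concept a := {x | Assertion.concept (.atom a) x ∈ A}
  role r x y := Assertion.role r x y ∈ A

theorem ABox.reaches_iff (A : ABox) (l : List ℕ) (x y : ℕ) :
    A.Reaches l x y ↔ A.toInterp.Reaches l x y := by
  induction l generalizing x with
  | nil => rfl
  | cons r l ih =>
    simp only [ABox.Reaches, Interp.Reaches, ih]
    rfl

theorem ABox.isSucc_iff (A : ABox) (R : Role) (x y : ℕ) :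
    A.IsSucc R x y ↔ R.interp A.toInterp x y := by
  rw [Role.interp_iff_reaches, ← ABox.reaches_iff]
  rfl

theorem ABox.exists_fresh (A : ABox) (k m : ℕ) :
    ∃ z : Fin k → Fin m → ℕ, Function.Injective (Function.uncurry z) ∧
      ∀ i j, ∀ a ∈ A, ¬ Assertion.Mentions (z i j) a := by
  obtain ⟨N, hN⟩ := A.names.exists_nat_subset_range
  refine ⟨fun i j => N + (Encodable.encode (i, j)), ?_, ?_⟩
  · rintro ⟨i, j⟩ ⟨i', j'⟩ h
    exact Encodable.encode_injective (Nat.add_left_cancel h)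
  · intro i j a ha hm
    have : N + Encodable.encode (i, j) < N :=
      Finset.mem_range.1 (hN (ABox.mem_names.2 ⟨a, ha, hm⟩))
    omega

/-! ### Soundness -/

/-- The number of constructors of a concept in normal form. -/
def NNF.size : NNF → ℕ
  | .and C D => C.size + D.size + 1
  | .or C D => C.size + D.size + 1
  | .geq _ _ C => C.size + 1
  | .leq _ _ C => C.size + 1
  | _ => 0

theorem NNF.size_neg_le (C : NNF) : C.neg.size ≤ C.size := by
  induction C with
  | geq n R C => cases n <;> simp [NNF.neg, NNF.size]
  | and => simp only [NNF.neg, NNF.size]; omega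
  | or => simp only [NNF.neg, NNF.size]; omega
  | _ => simp [NNF.neg, NNF.size]

/-- In a complete ABox every number restriction `≥ n` has enough instances: a maximal set of
asserted-to-be-different instances exists since the ABox is finite, and fresh names exist. -/
theorem ABox.Complete.exists_distinctInstances {A : ABox} (hA : A.Complete) {n : ℕ} {R : Role}
    {C : NNF} {x : ℕ} (h : Assertion.concept (.geq n R C) x ∈ A) :
    ∃ Y, A.DistinctInstances R C x Y ∧ n ≤ Y.card := by
  classical
  obtain ⟨Y, hY, hmax⟩ := Finset.exists_max_image
    (A.names.powerset.filter fun Y => A.DistinctInstances R C x Y) Finset.card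
    ⟨∅, Finset.mem_filter.2 ⟨by simp, fun y hy => absurd hy (Finset.notMem_empty y),
      fun y hy => absurd hy (Finset.notMem_empty y)⟩⟩
  rw [Finset.mem_filter] at hY
  refine ⟨Y, hY.2, ?_⟩
  by_contra! hn
  obtain ⟨z, hz, hz'⟩ := A.exists_fresh (n - Y.card) R.chain.length
  refine hA _ (.geq n R C x Y z h hY.2 (fun Y' hY' => hmax Y' ?_) hn hz hz')
  simpa using ⟨hY'.subset_names, hY'⟩

/-- The canonical interpretation of a complete and clash-free ABox is a model of its concept
assertions. -/
theorem ABox.Complete.mem_interp {A : ABox} (hA : A.Complete) (hc : ¬ A.Clash) (C : NNF) (x : ℕ)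
    (h : Assertion.concept C x ∈ A) : x ∈ C.interp A.toInterp := by
  match C with
  | .top => trivial
  | .bot => exact hc (.bot x h)
  | .atom a => exact h
  | .natom a => exact fun h' => hc (.atom a x h' h)
  | .and C D =>
    have := hA _ ∘ ABox.Rule.and C D x h
    rw [imp_false, not_not, Finset.insert_subset_iff, Finset.singleton_subset_iff] at this
    exact ⟨hA.mem_interp hc C x this.1, hA.mem_interp hc D x this.2⟩
  | .or C D =>
    by_cases hC : Assertion.concept C x ∈ A
    · exact Or.inl (hA.mem_interp hc C x hC)
    by_cases hD : Assertion.concept D x ∈ A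
    · exact Or.inr (hA.mem_interp hc D x hD)
    exact (hA _ (.or C D x h hC hD)).elim
  | .geq n R C =>
    obtain ⟨Y, hY, hn⟩ := hA.exists_distinctInstances h
    refine le_trans (Nat.cast_le (α := ℕ∞).2 hn) ?_
    rw [← Set.encard_coe_eq_coe_finsetCard]
    exact Set.encard_le_encard fun y hy =>
      ⟨(A.isSucc_iff R x y).1 (hY.1 y hy).1, hA.mem_interp hc C y (hY.1 y hy).2⟩
  | .leq n R C =>
    -- By the choose-rule, the successors in the extension of `C` are asserted to be in `C`.
    have key : ∀ y, A.IsSucc R x y → y ∈ C.interp A.toInterp → Assertion.concept C y ∈ A := by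
      intro y hy hyC
      by_contra hC
      by_cases hC' : Assertion.concept C.neg y ∈ A
      · have := hA.mem_interp hc C.neg y hC'
        rw [NNF.interp_neg] at this
        exact this hyC
      · exact hA _ (.choose n R C x y (Or.inr h) hy hC hC')
    change Set.encard _ ≤ _
    by_contra! hn
    obtain ⟨Y, hYs, hYn⟩ := Set.exists_subset_encard_eq (Order.add_one_le_of_lt hn)
    have hYf : Y.Finite :=
      Set.finite_of_encard_eq_coe (k := n + 1) (by rw [hYn]; norm_cast)
    lift Y to Finset ℕ using hYf
    have hcard : Y.card = n + 1 := by
      rw [Set.encard_coe_eq_coe_finsetCard] at hYn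
      exact_mod_cast hYn
    have hY : A.Instances R C x Y := fun y hy =>
      have hs := (A.isSucc_iff R x y).2 (hYs hy).1
      ⟨hs, key y hs (hYs hy).2⟩
    by_cases hne : ∃ y ∈ Y, ∃ y' ∈ Y, y ≠ y' ∧ Assertion.neq s(y, y') ∉ A
    · exact hA _ (.leq n R C x Y h hY (by omega) hne)
    · push Not at hne
      exact hc (.leq n R C x Y h ⟨hY, hne⟩ (by omega))
termination_by C.size
decreasing_by
  all_goals simp only [NNF.size]
  all_goals first | omega | (have := NNF.size_neg_le C; omega)

/-- Transport of an interpretation along `ULift`, to reach every universe. -/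
def Interp.ulift {Δ : Type} (I : Interp Δ) : Interp (ULift.{u} Δ) where
  concept a := {x | x.down ∈ I.concept a}
  role r x y := I.role r x.down y.down

theorem Role.interp_ulift {Δ : Type} (I : Interp Δ) (R : Role) (x y : ULift.{u} Δ) :
    R.interp I.ulift x y ↔ R.interp I x.down y.down := by
  induction R generalizing x y with
  | atom r => rfl
  | comp R S hR hS => simp [Role.interp, hR, hS, ULift.exists]

theorem Interp.encard_ulift {Δ : Type} (p : Δ → Prop) :
    {j : ULift.{u} Δ | p j.down}.encard = {j | p j}.encard :=
  Set.encard_congr (Equiv.ulift.subtypeEquiv fun _ => Iff.rfl)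

theorem Concept.interp_ulift {Δ : Type} (I : Interp Δ) (C : Concept) (x : ULift.{u} Δ) :
    x ∈ C.interp I.ulift ↔ x.down ∈ C.interp I := by
  induction C generalizing x with
  | top => simp [Concept.interp]
  | bot => simp [Concept.interp]
  | atom a => rfl
  | not C hC => simp [Concept.interp, hC]
  | and C D hC hD => simp [Concept.interp, hC, hD]
  | or C D hC hD => simp [Concept.interp, hC, hD]
  | all R C hC => simp [Concept.interp, hC, Role.interp_ulift]
  | ex R C hC => simp [Concept.interp, hC, Role.interp_ulift]
  | ge n R => simp [Concept.interp, Role.interp_ulift, Interp.encard_ulift (R.interp I x.down)]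
  | le n R => simp [Concept.interp, Role.interp_ulift, Interp.encard_ulift (R.interp I x.down)]
  | geq n R C hC =>
    simp [Concept.interp, hC, Role.interp_ulift,
      Interp.encard_ulift fun j => R.interp I x.down j ∧ j ∈ C.interp I]
  | leq n R C hC =>
    simp [Concept.interp, hC, Role.interp_ulift,
      Interp.encard_ulift fun j => R.interp I x.down j ∧ j ∈ C.interp I]

theorem Concept.satisfiable_of_mem {Δ : Type} (I : Interp Δ) {C : Concept} {x : Δ}
    (h : x ∈ C.interp I) : C.Satisfiable.{u} :=
  ⟨ULift Δ, ⟨⟨x⟩⟩, I.ulift, ⟨x⟩, (Concept.interp_ulift I C ⟨x⟩).2 h⟩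

/-- The input concept stays asserted, possibly of another individual. -/
theorem ABox.Step.concept_mem {A A' : ABox} {C : NNF} (h : A.Step A')
    (hA : ∃ x, Assertion.concept C x ∈ A) : ∃ x, Assertion.concept C x ∈ A' := by
  obtain ⟨S, hS, hA'⟩ := h
  obtain ⟨x, hx⟩ := hA
  cases hS with
  | and => rw [Set.mem_singleton_iff.1 hA']; exact ⟨x, by simp [hx]⟩
  | or => rcases hA' with rfl | rfl <;> exact ⟨x, by simp [hx]⟩
  | geq =>
    rw [Set.mem_singleton_iff.1 hA']
    exact ⟨x, by simp only [ABox.addSuccessors, Finset.mem_union]; tauto⟩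
  | leq =>
    obtain ⟨y, -, y', -, -, -, rfl⟩ := hA'
    exact ⟨_, Finset.mem_image_of_mem (Assertion.replace y y') hx⟩
  | choose => rcases hA' with rfl | rfl <;> exact ⟨x, by simp [hx]⟩

theorem satisfiable_of_complete {C : Concept} {A : ABox}
    (h : Relation.ReflTransGen ABox.Step (ABox.init C.nnf) A) (hA : A.Complete)
    (hc : ¬ A.Clash) : C.Satisfiable.{u} := by
  have : ∃ x, Assertion.concept C.nnf x ∈ A := by
    clear hA hc
    induction h with
    | refl => exact ⟨0, by simp [ABox.init]⟩
    | tail _ hs ih => exact hs.concept_mem ih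
  obtain ⟨x, hx⟩ := this
  have := hA.mem_interp hc _ x hx
  rw [Concept.interp_nnf] at this
  exact Concept.satisfiable_of_mem _ this

/-! ### Completeness -/

/-- The assertion holds in the interpretation `I` if names are interpreted by `π`. -/
def Assertion.Holds {Δ : Type u} (I : Interp Δ) (π : ℕ → Δ) : Assertion → Prop
  | .concept C x => π x ∈ C.interp I
  | .role r x y => I.role r (π x) (π y)
  | .neq p => ¬ (p.map π).IsDiag

/-- The pair `(I, π)` is a model of the ABox. -/
def ABox.Holds {Δ : Type u} (I : Interp Δ) (π : ℕ → Δ) (A : ABox) : Prop :=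
  ∀ s ∈ A, s.Holds I π

theorem Assertion.Holds.congr {Δ : Type u} {I : Interp Δ} {π π' : ℕ → Δ} {s : Assertion}
    (h : s.Holds I π) (hπ : ∀ a, s.Mentions a → π' a = π a) : s.Holds I π' := by
  cases s with
  | concept C x => simpa [Assertion.Holds, hπ x rfl] using h
  | role r x y => simpa [Assertion.Holds, hπ x (.inl rfl), hπ y (.inr rfl)] using h
  | neq p =>
    have : p.map π' = p.map π := Sym2.map_congr hπ
    simpa [Assertion.Holds, this] using h

theorem ABox.Holds.interp_of_isSucc {Δ : Type u} {I : Interp Δ} {π : ℕ → Δ} {A : ABox}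
    (h : A.Holds I π) {R : Role} {x y : ℕ} (hy : A.IsSucc R x y) : R.interp I (π x) (π y) := by
  rw [ABox.isSucc_iff, Role.interp_iff_reaches, Interp.reaches_iff_exists_path] at hy
  obtain ⟨f, rfl, rfl, hf⟩ := hy
  rw [Role.interp_iff_reaches, Interp.reaches_iff_exists_path]
  exact ⟨π ∘ f, rfl, rfl, fun i hi => h _ (hf i hi)⟩

theorem ABox.Holds.injOn {Δ : Type u} {I : Interp Δ} {π : ℕ → Δ} {A : ABox}
    (h : A.Holds I π) {R : Role} {C : NNF} {x : ℕ} {Y : Finset ℕ}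
    (hY : A.DistinctInstances R C x Y) : Set.InjOn π Y := by
  intro y hy y' hy' e
  by_contra hne
  exact h _ (hY.2 y hy y' hy' hne) (by simpa [Assertion.Holds] using e)

theorem ABox.Holds.image_subset {Δ : Type u} {I : Interp Δ} {π : ℕ → Δ} {A : ABox}
    (h : A.Holds I π) {R : Role} {C : NNF} {x : ℕ} {Y : Finset ℕ} (hY : A.Instances R C x Y) :
    π '' Y ⊆ {j | R.interp I (π x) j ∧ j ∈ C.interp I} := by
  rintro _ ⟨y, hy, rfl⟩
  exact ⟨h.interp_of_isSucc (hY y hy).1, h _ (hY y hy).2⟩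

theorem ABox.Holds.not_clash {Δ : Type u} {I : Interp Δ} {π : ℕ → Δ} {A : ABox}
    (h : A.Holds I π) : ¬ A.Clash := by
  rintro (⟨x, hx⟩ | ⟨a, x, hx, hx'⟩ | ⟨n, R, C, x, Y, hx, hY, hn⟩)
  · exact h _ hx
  · exact h _ hx' (h _ hx)
  · have h1 := (Set.encard_le_encard (h.image_subset hY.1)).trans (h _ hx)
    rw [(h.injOn hY).encard_image, Set.encard_coe_eq_coe_finsetCard, Nat.cast_le] at h1
    omega

theorem node_succ {m : ℕ} (x : ℕ) (z : Fin m → ℕ) (j : Fin m) : node x z j.succ = z j := rfl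

theorem node_zero {m : ℕ} (x : ℕ) (z : Fin m → ℕ) : node x z 0 = x := rfl

theorem node_last {m : ℕ} (x : ℕ) (z : Fin m → ℕ) (hm : 0 < m) :
    node x z (Fin.last m) = z ⟨m - 1, by omega⟩ := by
  rw [← node_succ x z]
  congr 1
  ext
  simp
  omega

/-- The values of a function along the path `x, z₁, …, zₘ`. -/
theorem apply_node {α : Type*} {m : ℕ} {x : ℕ} {z : Fin m → ℕ} {g : ℕ → α} {f : ℕ → α}
    (h0 : g x = f 0) (h : ∀ j, g (z j) = f (j + 1)) (j : Fin (m + 1)) :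
    g (node x z j) = f j := by
  refine Fin.cases ?_ (fun j => ?_) j
  · simpa [node_zero] using h0
  · simpa [node_succ] using h j

/-- The individuals added by the `≥`-rule can be interpreted by further successors in the model. -/
theorem ABox.Holds.addSuccessors {Δ : Type u} {I : Interp Δ} {π : ℕ → Δ} {A : ABox}
    (hA : A.Holds I π) {n : ℕ} {R : Role} {C : NNF} {x : ℕ} {Y : Finset ℕ}
    {z : Fin (n - Y.card) → Fin R.chain.length → ℕ}
    (h : Assertion.concept (.geq n R C) x ∈ A) (hY : A.DistinctInstances R C x Y)
    (hn : Y.card < n) (hz : Function.Injective (Function.uncurry z))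
    (hfresh : ∀ i j, ∀ a ∈ A, ¬ Assertion.Mentions (z i j) a) :
    ∃ π', (A.addSuccessors R C x Y z).Holds I π' := by
  -- Choose `n - Y.card` further successors in the model, together with paths to them.
  have hπx := hA _ h
  obtain ⟨T, hYT, hT, hTn⟩ := Set.exists_superset_subset_encard_eq (hA.image_subset hY.1)
    (by rw [(hA.injOn hY).encard_image, Set.encard_coe_eq_coe_finsetCard]; exact_mod_cast hn.le)
    hπx
  have hd : (T \ π '' Y).encard = ((n - Y.card : ℕ) : ℕ∞) := by
    have := Set.encard_sdiff_add_encard_of_subset hYT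
    rw [hTn, (hA.injOn hY).encard_image, Set.encard_coe_eq_coe_finsetCard] at this
    have h2 : (T \ π '' Y).encard + (Y.card : ℕ∞) = ((n - Y.card : ℕ) : ℕ∞) + Y.card := by
      rw [this]; norm_cast; omega
    exact (ENat.add_left_injective_of_ne_top (ENat.natCast_ne_top _)) h2
  have hfin := Set.finite_of_encard_eq_coe hd
  obtain ⟨e⟩ : Nonempty (Fin (n - Y.card) ≃ ↥(T \ π '' (Y : Set ℕ))) := by
    have := hfin.fintype
    refine ⟨(Fintype.equivFinOfCardEq ?_).symm⟩
    rw [Set.encard_eq_coe_toFinset_card, Set.toFinset_card] at hd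
    exact_mod_cast hd
  have hpath : ∀ i, ∃ f : ℕ → Δ, f 0 = π x ∧ f R.chain.length = e i ∧
      ∀ j (hj : j < R.chain.length), I.role R.chain[j] (f j) (f (j + 1)) := fun i =>
    (I.reaches_iff_exists_path _ _ _).1
      ((R.interp_iff_reaches I _ _).1 (hT (e i).2.1).1)
  choose f hf0 hf1 hf using hpath
  set π' : ℕ → Δ := Function.extend (Function.uncurry z) (fun p => f p.1 (p.2 + 1)) π with hπ'
  have hπz : ∀ i j, π' (z i j) = f i (j + 1) := fun i j =>
    hz.extend_apply (fun p : Fin (n - Y.card) × Fin R.chain.length => f p.1 (p.2 + 1)) π (i, j)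
  have hπA : ∀ a, a ∈ A.names → π' a = π a := by
    intro a ha
    obtain ⟨s, hs, hm⟩ := ABox.mem_names.1 ha
    refine Function.extend_apply' _ _ _ ?_
    rintro ⟨⟨i, j⟩, rfl⟩
    exact hfresh i j s hs hm
  have hx : π' x = π x := hπA x (ABox.mem_names_of_concept h)
  have hnode : ∀ i j, π' (node x (z i) j) = f i j := fun i j =>
    apply_node (hx.trans (hf0 i).symm) (hπz i) j
  have hlast : ∀ i, π' (node x (z i) (Fin.last _)) = e i := fun i => by
    rw [hnode, Fin.val_last, hf1]
  refine ⟨π', fun s hs => ?_⟩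
  simp only [ABox.addSuccessors, Finset.mem_union, Finset.mem_image, Finset.mem_univ, true_and,
    Finset.mem_filter, Finset.mem_product, and_true] at hs
  rcases hs with (((hs | ⟨⟨i, j⟩, rfl⟩) | ⟨i, rfl⟩) | ⟨⟨i, j⟩, hij, rfl⟩) | ⟨⟨y, i⟩, hy, rfl⟩
  · exact (hA s hs).congr fun a ha => hπA a (ABox.mem_names.2 ⟨s, hs, ha⟩)
  · simpa [Assertion.Holds, hnode] using hf i j j.2
  · simpa [Assertion.Holds, hlast] using (hT (e i).2.1).2
  · simp only [Assertion.Holds, Sym2.map_mk, Sym2.mk_isDiag_iff, hlast]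
    exact fun h => hij.ne (e.injective (Subtype.ext h))
  · simp only [Assertion.Holds, Sym2.map_mk, Sym2.mk_isDiag_iff, hlast,
      hπA y (hY.subset_names hy)]
    exact fun h => (e i).2.2 ⟨y, hy, h⟩

/-- Every completion rule applied to an ABox with a model can be resolved so that the result has
a model as well. -/
theorem ABox.Holds.exists_mem_rule {Δ : Type u} {I : Interp Δ} {π : ℕ → Δ} {A : ABox}
    (hA : A.Holds I π) {S : Set ABox} (hS : A.Rule S) : ∃ A' ∈ S, ∃ π', A'.Holds I π' := by
  have add : ∀ C x, π x ∈ C.interp I → (A ∪ {Assertion.concept C x}).Holds I π := by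
    intro C x h s hs
    rcases Finset.mem_union.1 hs with hs | hs
    · exact hA s hs
    · rw [Finset.mem_singleton.1 hs]; exact h
  cases hS with
  | and C D x h =>
    refine ⟨_, rfl, π, fun s hs => ?_⟩
    simp only [Finset.mem_union, Finset.mem_insert, Finset.mem_singleton] at hs
    rcases hs with hs | rfl | rfl
    · exact hA s hs
    · exact (hA _ h).1
    · exact (hA _ h).2
  | or C D x h =>
    rcases hA _ h with h | h
    · exact ⟨_, Or.inl rfl, π, add C x h⟩
    · exact ⟨_, Or.inr rfl, π, add D x h⟩
  | geq n R C x Y z h hY hmax hn hz hfresh =>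
    exact ⟨_, rfl, hA.addSuccessors h hY hn hz hfresh⟩
  | leq n R C x Y h hY hn =>
    -- The interpretation identifies two of the instances, which cannot be asserted different.
    have : ¬ Set.InjOn π Y := by
      intro hinj
      have h1 := (Set.encard_le_encard (hA.image_subset hY)).trans (hA _ h)
      rw [hinj.encard_image, Set.encard_coe_eq_coe_finsetCard, Nat.cast_le] at h1
      omega
    simp only [Set.InjOn, not_forall] at this
    obtain ⟨y, hy, y', hy', e, hne⟩ := this
    refine ⟨_, ⟨y, hy, y', hy', hne, fun hm => hA _ hm (by simpa using e), rfl⟩, π, ?_⟩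
    have hrep : ∀ a, π (if a = y then y' else a) = π a := by
      intro a
      split_ifs with ha
      · rw [ha, e]
      · rfl
    intro s hs
    obtain ⟨t, ht, rfl⟩ := Finset.mem_image.1 hs
    have := hA t ht
    cases t with
    | concept D a => simpa [Assertion.replace, Assertion.Holds, hrep] using this
    | role r a b => simpa [Assertion.replace, Assertion.Holds, hrep] using this
    | neq p =>
      have : (p.map fun a => if a = y then y' else a).map π = p.map π := by
        rw [Sym2.map_map]; exact Sym2.map_congr fun a _ => hrep a
      simpa [Assertion.replace, Assertion.Holds, this] using hA _ ht
  | choose n R C x y =>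
    by_cases hy : π y ∈ C.interp I
    · exact ⟨_, Or.inl rfl, π, add C y hy⟩
    · exact ⟨_, Or.inr rfl, π, add C.neg y (by rwa [NNF.interp_neg])⟩

/-! ### A termination measure -/

/-- The number of role steps below an individual that a concept can speak about. -/
def NNF.depth : NNF → ℕ
  | .and C D => max C.depth D.depth
  | .or C D => max C.depth D.depth
  | .geq _ R C => R.chain.length + C.depth
  | .leq _ R C => R.chain.length + C.depth
  | _ => 0

theorem NNF.depth_neg_le (C : NNF) : C.neg.depth ≤ C.depth := by
  induction C with
  | geq n R C => cases n <;> simp [NNF.neg, NNF.depth]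
  | and => simp only [NNF.neg, NNF.depth]; omega
  | or => simp only [NNF.neg, NNF.depth]; omega
  | _ => simp [NNF.neg, NNF.depth]

/-- The set is closed under the concepts that the completion rules produce. -/
structure IsRuleClosed (S : Set NNF) : Prop where
  and : ∀ {C D}, .and C D ∈ S → C ∈ S ∧ D ∈ S
  or : ∀ {C D}, .or C D ∈ S → C ∈ S ∧ D ∈ S
  geq : ∀ {n R C}, .geq n R C ∈ S → C ∈ S ∧ C.neg ∈ S
  leq : ∀ {n R C}, .leq n R C ∈ S → C ∈ S ∧ C.neg ∈ S

/-- The completion rules produce subconcepts and normal forms of their negations only. A set closed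
under `∼` is not needed: the choose-rule negates only the concepts inside number restrictions. -/
theorem exists_isRuleClosed (C : NNF) :
    ∃ S : Finset NNF, IsRuleClosed S ∧ C ∈ S ∧ C.neg ∈ S := by
  classical
  induction C with
  | and C D hC hD =>
    obtain ⟨S, hS, h1, h2⟩ := hC
    obtain ⟨T, hT, h3, h4⟩ := hD
    refine ⟨S ∪ T ∪ {.and C D, (NNF.and C D).neg}, ?_, by simp, by simp⟩
    obtain ⟨a, b, c, d⟩ := hS
    obtain ⟨a', b', c', d'⟩ := hT
    constructor <;> simp only [Finset.coe_union, Finset.coe_insert, Finset.coe_singleton,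
      Set.mem_union, Set.mem_insert_iff, Set.mem_singleton_iff, NNF.neg, NNF.and.injEq,
      NNF.or.injEq, reduceCtorEq, Finset.mem_coe] at * <;> grind
  | or C D hC hD =>
    obtain ⟨S, hS, h1, h2⟩ := hC
    obtain ⟨T, hT, h3, h4⟩ := hD
    refine ⟨S ∪ T ∪ {.or C D, (NNF.or C D).neg}, ?_, by simp, by simp⟩
    obtain ⟨a, b, c, d⟩ := hS
    obtain ⟨a', b', c', d'⟩ := hT
    constructor <;> simp only [Finset.coe_union, Finset.coe_insert, Finset.coe_singleton,
      Set.mem_union, Set.mem_insert_iff, Set.mem_singleton_iff, NNF.neg, NNF.and.injEq,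
      NNF.or.injEq, reduceCtorEq, Finset.mem_coe] at * <;> grind
  | geq n R C hC =>
    obtain ⟨S, hS, h1, h2⟩ := hC
    refine ⟨S ∪ {.geq n R C, (NNF.geq n R C).neg}, ?_, by simp, by simp⟩
    obtain ⟨a, b, c, d⟩ := hS
    cases n <;> constructor <;> simp only [Finset.coe_union, Finset.coe_insert,
      Finset.coe_singleton,
      Set.mem_union, Set.mem_insert_iff, Set.mem_singleton_iff, NNF.neg, NNF.geq.injEq,
      NNF.leq.injEq, reduceCtorEq, Finset.mem_coe] at * <;> grind
  | leq n R C hC =>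
    obtain ⟨S, hS, h1, h2⟩ := hC
    refine ⟨S ∪ {.leq n R C, (NNF.leq n R C).neg}, ?_, by simp, by simp⟩
    obtain ⟨a, b, c, d⟩ := hS
    constructor <;> simp only [Finset.coe_union, Finset.coe_insert, Finset.coe_singleton,
      Set.mem_union, Set.mem_insert_iff, Set.mem_singleton_iff, NNF.neg, NNF.geq.injEq,
      NNF.leq.injEq, reduceCtorEq, Finset.mem_coe] at * <;> grind
  | top => exact ⟨{.top, .bot}, by constructor <;> simp, by simp [NNF.neg]⟩
  | bot => exact ⟨{.top, .bot}, by constructor <;> simp, by simp [NNF.neg]⟩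
  | atom a => exact ⟨{.atom a, .natom a}, by constructor <;> simp, by simp [NNF.neg]⟩
  | natom a => exact ⟨{.atom a, .natom a}, by constructor <;> simp, by simp [NNF.neg]⟩

/-- Invariant of the algorithm: `lev` assigns to each individual its distance from the root, and
`S` contains the asserted concepts, which speak about the first `d` levels only. -/
structure Invariant (S : Finset NNF) (d : ℕ) (A : ABox) (lev : ℕ → ℕ) : Prop where
  role : ∀ {r x y}, Assertion.role r x y ∈ A → lev y = lev x + 1
  mem : ∀ {C x}, Assertion.concept C x ∈ A → C ∈ S
  depth : ∀ {C x}, Assertion.concept C x ∈ A → lev x + C.depth ≤ d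

theorem Invariant.lev_of_isSucc {S : Finset NNF} {d : ℕ} {A : ABox} {lev : ℕ → ℕ}
    (h : Invariant S d A lev) {R : Role} {x y : ℕ} (hy : A.IsSucc R x y) :
    lev y = lev x + R.chain.length := by
  unfold ABox.IsSucc at hy
  generalize R.chain = l at hy ⊢
  induction l generalizing x with
  | nil => cases hy; rfl
  | cons r l ih =>
    obtain ⟨z, hz, hy⟩ := hy
    rw [ih hy, h.role hz, List.length_cons]
    omega

open Classical in
/-- The concepts of `S` that are not yet asserted of `x`. -/
noncomputable def ABox.missing (S : Finset NNF) (A : ABox) (x : ℕ) : Finset NNF :=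
  S.filter fun C => Assertion.concept C x ∉ A

open Classical in
/-- The at-least restrictions in `S`, asserted of `x` or not, for which `x` lacks
asserted-to-be-different instances. -/
noncomputable def ABox.lacking (S : Finset NNF) (A : ABox) (x : ℕ) : Finset NNF :=
  S.filter fun C => ∃ n R D, C = .geq n R D ∧
    ¬ ∃ Y, A.DistinctInstances R D x Y ∧ n ≤ Y.card

theorem ABox.mem_missing {S : Finset NNF} {A : ABox} {x : ℕ} {C : NNF} :
    C ∈ A.missing S x ↔ C ∈ S ∧ Assertion.concept C x ∉ A := Finset.mem_filter

theorem ABox.mem_lacking {S : Finset NNF} {A : ABox} {x : ℕ} {C : NNF} :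
    C ∈ A.lacking S x ↔ C ∈ S ∧ ∃ n R D, C = .geq n R D ∧
      ¬ ∃ Y, A.DistinctInstances R D x Y ∧ n ≤ Y.card := by
  classical exact Finset.mem_filter

/-- The cost of an individual: one for its presence, one for each concept of `S` that may still be
asserted of it, and one for each at-least restriction of `S` whose rule may still be applied to it. -/
noncomputable def ABox.cost (S : Finset NNF) (A : ABox) (x : ℕ) : ℕ :=
  1 + (A.missing S x).card + (A.lacking S x).card

/-- The total cost of the individuals on each of the levels `0, …, d`. -/
noncomputable def ABox.levelCost (S : Finset NNF) (d : ℕ) (A : ABox) (lev : ℕ → ℕ) :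
    Lex (Fin (d + 1) → ℕ) :=
  toLex fun i => ∑ x ∈ A.names with lev x = i, A.cost S x

theorem toLex_lt_of_le_of_lt {n : ℕ} {f g : Fin n → ℕ} (i : Fin n) (hle : ∀ j ≤ i, f j ≤ g j)
    (hlt : f i < g i) : toLex f < toLex g := by
  induction i using WellFoundedLT.induction with
  | _ i ih =>
    by_cases h : ∃ j < i, f j < g j
    · obtain ⟨j, hj, hlt'⟩ := h
      exact ih j hj (fun k hk => hle k (hk.trans hj.le)) hlt'
    · push Not at h
      exact ⟨i, fun j hj => le_antisymm (hle j hj.le) (h j hj), hlt⟩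

/-- The level cost decreases if, up to level `i`, no individuals are added, no costs grow, and
some individual of level `i` disappears or becomes cheaper. -/
theorem ABox.levelCost_lt {S : Finset NNF} {d : ℕ} {A A' : ABox} {lev lev' : ℕ → ℕ} {x : ℕ}
    (hx : x ∈ A.names) (hd : lev x ≤ d)
    (h : ∀ a ∈ A'.names, lev' a ≤ lev x →
      a ∈ A.names ∧ lev a = lev' a ∧ A'.cost S a ≤ A.cost S a)
    (hlt : x ∈ A'.names → A'.cost S x < A.cost S x) :
    A'.levelCost S d lev' < A.levelCost S d lev := by
  have hsub : ∀ i ≤ lev x, (A'.names.filter fun a => lev' a = i) ⊆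
      A.names.filter fun a => lev a = i := by
    intro i hi a ha
    rw [Finset.mem_filter] at ha ⊢
    obtain ⟨h1, h2, -⟩ := h a ha.1 (ha.2.trans_le hi)
    exact ⟨h1, h2.trans ha.2⟩
  have hcost : ∀ i ≤ lev x, ∀ a ∈ A'.names.filter fun a => lev' a = i,
      A'.cost S a ≤ A.cost S a := by
    intro i hi a ha
    rw [Finset.mem_filter] at ha
    exact (h a ha.1 (ha.2.trans_le hi)).2.2
  refine toLex_lt_of_le_of_lt ⟨lev x, by omega⟩ (fun i hi => ?_) ?_
  · exact (Finset.sum_le_sum (hcost i hi)).trans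
      (Finset.sum_le_sum_of_subset (hsub i hi))
  · by_cases hx' : x ∈ A'.names.filter fun a => lev' a = lev x
    · exact (Finset.sum_lt_sum (hcost _ le_rfl)
        ⟨x, hx', hlt (Finset.mem_filter.1 hx').1⟩).trans_le
        (Finset.sum_le_sum_of_subset (hsub _ le_rfl))
    · refine (Finset.sum_le_sum (hcost _ le_rfl)).trans_lt ?_
      exact Finset.sum_lt_sum_of_subset (hsub _ le_rfl) (by simpa using hx) hx'
        (by simp only [ABox.cost]; omega) fun _ _ _ => Nat.zero_le _

/-! ### Homomorphisms between ABoxes -/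

/-- `f` maps the role, concept and inequality assertions of `A` to assertions of `A'`. -/
structure ABox.Hom (A A' : ABox) (f : ℕ → ℕ) : Prop where
  concept : ∀ {C x}, Assertion.concept C x ∈ A → Assertion.concept C (f x) ∈ A'
  role : ∀ {r x y}, Assertion.role r x y ∈ A → Assertion.role r (f x) (f y) ∈ A'
  neq : ∀ {x y}, x ≠ y → Assertion.neq s(x, y) ∈ A → f x ≠ f y ∧ Assertion.neq s(f x, f y) ∈ A'

theorem ABox.Hom.isSucc {A A' : ABox} {f : ℕ → ℕ} (hf : A.Hom A' f) {R : Role} {x y : ℕ}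
    (h : A.IsSucc R x y) : A'.IsSucc R (f x) (f y) := by
  unfold ABox.IsSucc at *
  generalize R.chain = l at h ⊢
  induction l generalizing x with
  | nil => cases h; rfl
  | cons r l ih =>
    obtain ⟨z, hz, h⟩ := h
    exact ⟨f z, hf.role hz, ih h⟩

theorem ABox.Hom.distinctInstances {A A' : ABox} {f : ℕ → ℕ} (hf : A.Hom A' f) {R : Role}
    {C : NNF} {x : ℕ} {Y : Finset ℕ} (h : A.DistinctInstances R C x Y) :
    A'.DistinctInstances R C (f x) (Y.image f) ∧ (Y.image f).card = Y.card := by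
  refine ⟨⟨?_, ?_⟩, Finset.card_image_of_injOn fun y hy y' hy' e => ?_⟩
  · intro _ hw
    obtain ⟨y, hy, rfl⟩ := Finset.mem_image.1 hw
    exact ⟨hf.isSucc (h.1 y hy).1, hf.concept (h.1 y hy).2⟩
  · intro _ hw _ hw' hne
    obtain ⟨y, hy, rfl⟩ := Finset.mem_image.1 hw
    obtain ⟨y', hy', rfl⟩ := Finset.mem_image.1 hw'
    have hne' : y ≠ y' := fun e => hne (e ▸ rfl)
    exact (hf.neq hne' (h.2 y hy y' hy' hne')).2
  · by_contra hne
    exact (hf.neq hne (h.2 y hy y' hy' hne)).1 e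

theorem ABox.Hom.missing_subset {A A' : ABox} {f : ℕ → ℕ} (hf : A.Hom A' f) (S : Finset NNF)
    {x : ℕ} (hx : f x = x) : A'.missing S x ⊆ A.missing S x := by
  intro C hC
  rw [ABox.mem_missing] at hC ⊢
  exact ⟨hC.1, fun h => hC.2 (by simpa [hx] using hf.concept h)⟩

theorem ABox.Hom.lacking_subset {A A' : ABox} {f : ℕ → ℕ} (hf : A.Hom A' f) (S : Finset NNF)
    {x : ℕ} (hx : f x = x) : A'.lacking S x ⊆ A.lacking S x := by
  intro C hC
  obtain ⟨hC, n, R, D, rfl, h⟩ := ABox.mem_lacking.1 hC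
  refine ABox.mem_lacking.2 ⟨hC, n, R, D, rfl, fun ⟨Y, hY, hn⟩ => h ⟨Y.image f, ?_⟩⟩
  obtain ⟨h1, h2⟩ := hf.distinctInstances hY
  exact ⟨by simpa [hx] using h1, by omega⟩

theorem ABox.Hom.cost_le {A A' : ABox} {f : ℕ → ℕ} (hf : A.Hom A' f) (S : Finset NNF)
    {x : ℕ} (hx : f x = x) : A'.cost S x ≤ A.cost S x := by
  have h1 := Finset.card_le_card (hf.missing_subset S hx)
  have h2 := Finset.card_le_card (hf.lacking_subset S hx)
  simp only [ABox.cost]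
  omega

theorem ABox.hom_of_subset {A A' : ABox} (h : A ⊆ A') : A.Hom A' id :=
  ⟨fun h1 => h h1, fun h1 => h h1, fun h1 h2 => ⟨h1, h h2⟩⟩

theorem ABox.cost_lt_of_concept {A A' : ABox} {S : Finset NNF} (h : A ⊆ A') {C : NNF} {x : ℕ}
    (hS : C ∈ S) (hC : Assertion.concept C x ∉ A) (hC' : Assertion.concept C x ∈ A') :
    A'.cost S x < A.cost S x := by
  have hf := ABox.hom_of_subset h
  have h1 : (A'.missing S x).card < (A.missing S x).card := by
    refine Finset.card_lt_card ((Finset.ssubset_iff_of_subset (hf.missing_subset S rfl)).2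
      ⟨C, ABox.mem_missing.2 ⟨hS, hC⟩, fun h => (ABox.mem_missing.1 h).2 hC'⟩)
  have h2 := Finset.card_le_card (hf.lacking_subset S (x := x) rfl)
  simp only [ABox.cost]
  omega

/-! ### Termination of the completion rules -/

/-- Rules that add concept assertions about one individual lower the level cost. -/
theorem Invariant.add_concepts {S : Finset NNF} {d : ℕ} {A : ABox} {lev : ℕ → ℕ}
    (h : Invariant S d A lev) {x : ℕ} (hx : x ∈ A.names) (T : Finset NNF)
    (hT : ∀ C ∈ T, C ∈ S ∧ lev x + C.depth ≤ d) {C : NNF} (hC : C ∈ T)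
    (hCA : Assertion.concept C x ∉ A) :
    Invariant S d (A ∪ T.image fun D => Assertion.concept D x) lev ∧
      (A ∪ T.image fun D => Assertion.concept D x).levelCost S d lev <
        A.levelCost S d lev := by
  have hsub : A ⊆ A ∪ T.image fun D => Assertion.concept D x := Finset.subset_union_left
  refine ⟨⟨?_, ?_, ?_⟩, ABox.levelCost_lt hx (by have := (hT C hC).2; omega) ?_ ?_⟩
  · intro r a b hr
    exact h.role (by simpa using hr)
  · intro D a hD
    simp only [Finset.mem_union, Finset.mem_image, Assertion.concept.injEq] at hD
    obtain hD | ⟨D, hD, rfl, rfl⟩ := hD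
    · exact h.mem hD
    · exact (hT D hD).1
  · intro D a hD
    simp only [Finset.mem_union, Finset.mem_image, Assertion.concept.injEq] at hD
    obtain hD | ⟨D, hD, rfl, rfl⟩ := hD
    · exact h.depth hD
    · exact (hT D hD).2
  · intro a ha _
    refine ⟨?_, rfl, (ABox.hom_of_subset hsub).cost_le S rfl⟩
    obtain ⟨s, hs, hm⟩ := ABox.mem_names.1 ha
    simp only [Finset.mem_union, Finset.mem_image] at hs
    obtain hs | ⟨D, -, rfl⟩ := hs
    · exact ABox.mem_names.2 ⟨s, hs, hm⟩
    · cases hm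
      exact hx
  · exact fun _ => ABox.cost_lt_of_concept hsub (hT C hC).1 hCA
      (Finset.mem_union_right _ (Finset.mem_image_of_mem _ hC))

theorem Invariant.add_concept {S : Finset NNF} {d : ℕ} {A : ABox} {lev : ℕ → ℕ}
    (h : Invariant S d A lev) {x : ℕ} (hx : x ∈ A.names) {C : NNF} (hS : C ∈ S)
    (hd : lev x + C.depth ≤ d) (hCA : Assertion.concept C x ∉ A) :
    Invariant S d (A ∪ {Assertion.concept C x}) lev ∧
      (A ∪ {Assertion.concept C x}).levelCost S d lev < A.levelCost S d lev := by
  have := h.add_concepts hx {C} (by simpa using ⟨hS, hd⟩) (Finset.mem_singleton_self C) hCA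
  rwa [Finset.image_singleton] at this

/-- The ABox in which `y` is replaced by `y'` everywhere. -/
noncomputable abbrev ABox.identify (A : ABox) (y y' : ℕ) : ABox :=
  A.image (Assertion.replace y y')

/-- Individuals that are not asserted to be different may be identified without merging any two
individuals that are asserted to be different. -/
theorem ABox.hom_replace {A : ABox} {y y' : ℕ} (hne : Assertion.neq s(y, y') ∉ A) :
    A.Hom (A.identify y y') fun a => if a = y then y' else a := by
  refine ⟨fun h => Finset.mem_image_of_mem (Assertion.replace y y') h,
    fun h => Finset.mem_image_of_mem (Assertion.replace y y') h,
    fun {a b} hab h => ⟨?_, Finset.mem_image_of_mem (Assertion.replace y y') h⟩⟩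
  intro e
  split_ifs at e with h1 h2 h2
  · exact hab (h1.trans h2.symm)
  · subst h1 e; exact hne h
  · subst h2 e; exact hne (Sym2.eq_swap ▸ h)
  · exact hab e

theorem ABox.names_replace {A : ABox} {y y' : ℕ} (hne : y ≠ y') {a : ℕ}
    (ha : a ∈ (A.identify y y').names) : a ≠ y ∧ (a ∈ A.names ∨ a = y') := by
  obtain ⟨s, hs, hm⟩ := ABox.mem_names.1 ha
  obtain ⟨t, ht, rfl⟩ := Finset.mem_image.1 hs
  obtain ⟨b, hb, rfl⟩ : ∃ b, t.Mentions b ∧ a = if b = y then y' else b := by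
    cases t with
    | concept C x => exact ⟨x, rfl, hm⟩
    | role r x z => exact hm.elim (fun h => ⟨x, .inl rfl, h⟩) fun h => ⟨z, .inr rfl, h⟩
    | neq p =>
      obtain ⟨b, hb, rfl⟩ := Sym2.mem_map.1 hm
      exact ⟨b, hb, rfl⟩
  split_ifs with h
  · exact ⟨hne.symm, .inr rfl⟩
  · exact ⟨h, .inl (ABox.mem_names.2 ⟨t, ht, hb⟩)⟩

/-- The `≤`-rule lowers the level cost, as it removes an individual. -/
theorem Invariant.replace {S : Finset NNF} {d : ℕ} {A : ABox} {lev : ℕ → ℕ}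
    (h : Invariant S d A lev) {y y' : ℕ} (hy : y ∈ A.names) (hy' : y' ∈ A.names)
    (hlev : lev y = lev y') (hd : lev y ≤ d) (hyy' : y ≠ y')
    (hne : Assertion.neq s(y, y') ∉ A) :
    Invariant S d (A.identify y y') lev ∧
      (A.identify y y').levelCost S d lev < A.levelCost S d lev := by
  have hrep : ∀ a, lev (if a = y then y' else a) = lev a := by
    intro a
    split_ifs with h
    · rw [h, hlev]
    · rfl
  refine ⟨⟨?_, ?_, ?_⟩, ABox.levelCost_lt hy hd ?_ ?_⟩
  · intro r a b hs
    obtain ⟨t, ht, e⟩ := Finset.mem_image.1 hs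
    cases t <;> cases e
    simpa only [hrep] using h.role ht
  · intro C a hs
    obtain ⟨t, ht, e⟩ := Finset.mem_image.1 hs
    cases t <;> cases e
    exact h.mem ht
  · intro C a hs
    obtain ⟨t, ht, e⟩ := Finset.mem_image.1 hs
    cases t <;> cases e
    simpa only [hrep] using h.depth ht
  · intro a ha _
    obtain ⟨h1, h2⟩ := ABox.names_replace hyy' ha
    exact ⟨h2.elim id fun h => h ▸ hy', rfl, (ABox.hom_replace hne).cost_le S (if_neg h1)⟩
  · exact fun hy => absurd rfl (ABox.names_replace hyy' hy).1

theorem ABox.isSucc_of_path {A : ABox} {R : Role} {f : ℕ → ℕ}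
    (h : ∀ i (hi : i < R.chain.length), Assertion.role R.chain[i] (f i) (f (i + 1)) ∈ A) :
    A.IsSucc R (f 0) (f R.chain.length) := by
  rw [ABox.isSucc_iff, Role.interp_iff_reaches, Interp.reaches_iff_exists_path]
  exact ⟨f, rfl, rfl, h⟩

/-- After the rule for `≥ n` there are `n` asserted-to-be-different instances. -/
theorem ABox.addSuccessors_distinctInstances {A : ABox} {n : ℕ} {R : Role} {C : NNF} {x : ℕ}
    {Y : Finset ℕ} {z : Fin (n - Y.card) → Fin R.chain.length → ℕ}
    (hY : A.DistinctInstances R C x Y) (hz : Function.Injective (Function.uncurry z))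
    (hfresh : ∀ i j, z i j ∉ A.names) :
    ∃ Y', (A.addSuccessors R C x Y z).DistinctInstances R C x Y' ∧ n ≤ Y'.card := by
  classical
  set A' := A.addSuccessors R C x Y z with hA'
  have hsub : A ⊆ A' := fun s hs => by simp [hA', ABox.addSuccessors, hs]
  have hpos := R.chain_length_pos
  set e : Fin (n - Y.card) → ℕ := fun i => node x (z i) (Fin.last _) with he
  have hez : ∀ i, e i = z i ⟨R.chain.length - 1, by omega⟩ := fun i => node_last x (z i) hpos
  have hinj : Function.Injective e := by
    intro i i' hii
    rw [hez, hez] at hii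
    exact congrArg Prod.fst (@hz (i, _) (i', _) hii)
  have hdisj : ∀ i, e i ∉ Y := fun i hi =>
    hfresh _ _ (hez i ▸ hY.subset_names hi)
  have hneq : ∀ i i', i < i' → Assertion.neq s(e i, e i') ∈ A' := by
    intro i i' h
    simp only [hA', ABox.addSuccessors, Finset.mem_union, Finset.mem_image, Finset.mem_filter]
    exact Or.inl (Or.inr ⟨(i, i'), by simpa using h, rfl⟩)
  have hneq' : ∀ y ∈ Y, ∀ i, Assertion.neq s(y, e i) ∈ A' := by
    intro y hy i
    simp only [hA', ABox.addSuccessors, Finset.mem_union, Finset.mem_image, Finset.mem_product]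
    exact Or.inr ⟨(y, i), by simpa using hy, rfl⟩
  have hYA' : A'.DistinctInstances R C x Y := by
    have := ((ABox.hom_of_subset hsub).distinctInstances hY).1
    rwa [Finset.image_id] at this
  refine ⟨Y ∪ Finset.univ.image e, ⟨?_, ?_⟩, ?_⟩
  · intro y hy
    simp only [Finset.mem_union, Finset.mem_image, Finset.mem_univ, true_and] at hy
    obtain hy | ⟨i, rfl⟩ := hy
    · exact hYA'.1 y hy
    · constructor
      · have := @ABox.isSucc_of_path A' R
          (fun j => if h : j < R.chain.length + 1 then node x (z i) ⟨j, h⟩ else 0) ?_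
        · simpa [node_zero, he, Fin.last] using this
        · intro j hj
          rw [dif_pos (by omega), dif_pos (by omega)]
          simp only [hA', ABox.addSuccessors, Finset.mem_union, Finset.mem_image]
          exact Or.inl (Or.inl (Or.inl (Or.inr ⟨(i, ⟨j, hj⟩), Finset.mem_univ _, rfl⟩)))
      · simp only [hA', ABox.addSuccessors, Finset.mem_union, Finset.mem_image]
        exact Or.inl (Or.inl (Or.inr ⟨i, Finset.mem_univ _, rfl⟩))
  · intro y hy y' hy' hne
    simp only [Finset.mem_union, Finset.mem_image, Finset.mem_univ, true_and] at hy hy'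
    obtain hy | ⟨i, rfl⟩ := hy <;> obtain hy' | ⟨i', rfl⟩ := hy'
    · exact hYA'.2 y hy y' hy' hne
    · exact hneq' y hy i'
    · rw [Sym2.eq_swap]; exact hneq' y' hy' i
    · rcases lt_trichotomy i i' with h | rfl | h
      · exact hneq _ _ h
      · exact absurd rfl hne
      · rw [Sym2.eq_swap]; exact hneq _ _ h
  · rw [Finset.card_union_of_disjoint, Finset.card_image_of_injective _ hinj, Finset.card_univ,
      Fintype.card_fin]
    · omega
    · rw [Finset.disjoint_left]
      rintro y hy h
      obtain ⟨i, -, rfl⟩ := Finset.mem_image.1 h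
      exact hdisj i hy

/-- The `≥`-rule lowers the level cost: the new individuals lie above the level of `x`, and the
restriction no longer lacks instances at `x`. -/
theorem Invariant.addSuccessors {S : Finset NNF} {d : ℕ} {A : ABox} {lev : ℕ → ℕ}
    (hI : Invariant S d A lev) (hS : IsRuleClosed S) {n : ℕ} {R : Role} {C : NNF} {x : ℕ}
    {Y : Finset ℕ} {z : Fin (n - Y.card) → Fin R.chain.length → ℕ}
    (h : Assertion.concept (.geq n R C) x ∈ A) (hY : A.DistinctInstances R C x Y)
    (hmax : ∀ Y' : Finset ℕ, A.DistinctInstances R C x Y' → Y'.card ≤ Y.card)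
    (hn : Y.card < n) (hz : Function.Injective (Function.uncurry z))
    (hfresh : ∀ i j, z i j ∉ A.names) :
    ∃ lev', Invariant S d (A.addSuccessors R C x Y z) lev' ∧
      (A.addSuccessors R C x Y z).levelCost S d lev' < A.levelCost S d lev := by
  have hdepth := hI.depth h
  simp only [NNF.depth] at hdepth
  have hxA := ABox.mem_names_of_concept h
  set lev' : ℕ → ℕ := Function.extend (Function.uncurry z) (fun p => lev x + (p.2 + 1)) lev
  have hlevz : ∀ i j, lev' (z i j) = lev x + (j + 1) := fun i j =>
    hz.extend_apply (fun p : Fin (n - Y.card) × Fin R.chain.length => lev x + (p.2.val + 1))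
      lev (i, j)
  have hlevA : ∀ a ∈ A.names, lev' a = lev a := by
    intro a ha
    refine Function.extend_apply' _ _ _ ?_
    rintro ⟨⟨i, j⟩, rfl⟩
    exact hfresh i j ha
  have hnode : ∀ i j, lev' (node x (z i) j) = lev x + j := fun i j =>
    apply_node (f := fun j => lev x + j) (hlevA x hxA) (hlevz i) j
  have hnames : ∀ i j, node x (z i) j = x ∨ ∃ j', node x (z i) j = z i j' := fun i j =>
    Fin.cases (Or.inl rfl) (fun j => Or.inr ⟨j, rfl⟩) j
  have hsub : A ⊆ A.addSuccessors R C x Y z := fun s hs => by simp [ABox.addSuccessors, hs]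
  have hhom := ABox.hom_of_subset hsub
  refine ⟨lev', ⟨?_, ?_, ?_⟩, ABox.levelCost_lt hxA (by omega) ?_ ?_⟩
  · intro r a b hr
    simp only [ABox.addSuccessors, Finset.mem_union, Finset.mem_image, reduceCtorEq, and_false,
      exists_false, or_false, Assertion.role.injEq] at hr
    obtain hr | ⟨⟨i, j⟩, -, -, rfl, rfl⟩ := hr
    · rw [hlevA a (ABox.mem_names.2 ⟨_, hr, .inl rfl⟩),
        hlevA b (ABox.mem_names.2 ⟨_, hr, .inr rfl⟩), hI.role hr]
    · rw [hnode, hnode]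
      simp
      omega
  · intro D a hD
    simp only [ABox.addSuccessors, Finset.mem_union, Finset.mem_image, reduceCtorEq, and_false,
      exists_false, or_false, Assertion.concept.injEq] at hD
    obtain hD | ⟨i, -, rfl, rfl⟩ := hD
    · exact hI.mem hD
    · exact (hS.geq (hI.mem h)).1
  · intro D a hD
    simp only [ABox.addSuccessors, Finset.mem_union, Finset.mem_image, reduceCtorEq, and_false,
      exists_false, or_false, Assertion.concept.injEq] at hD
    obtain hD | ⟨i, -, rfl, rfl⟩ := hD
    · rw [hlevA a (ABox.mem_names_of_concept hD)]
      exact hI.depth hD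
    · rw [hnode, Fin.val_last]
      omega
  · intro a ha hle
    have haA : a ∈ A.names := by
      by_contra hna
      -- All names other than those of `A` are fresh, hence of a level above that of `x`.
      suffices ∃ i j, a = z i j by
        obtain ⟨i, j, rfl⟩ := this
        rw [hlevz] at hle
        omega
      have hcases : ∀ i j, a = node x (z i) j → ∃ i j, a = z i j := by
        intro i j e
        obtain e' | ⟨j', e'⟩ := hnames i j
        · exact absurd ((e.trans e').symm ▸ hxA) hna
        · exact ⟨i, j', e.trans e'⟩
      obtain ⟨s, hs, hm⟩ := ABox.mem_names.1 ha
      simp only [ABox.addSuccessors, Finset.mem_union, Finset.mem_image, Finset.mem_product] at hs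
      rcases hs with (((hs | ⟨⟨i, j⟩, -, rfl⟩) | ⟨i, -, rfl⟩) | ⟨⟨i, j⟩, -, rfl⟩) |
        ⟨⟨y, i⟩, hy, rfl⟩
      · exact absurd (ABox.mem_names.2 ⟨s, hs, hm⟩) hna
      · exact hm.elim (hcases i _) (hcases i _)
      · exact hcases i _ hm
      · exact (Sym2.mem_iff.1 hm).elim (hcases i _) (hcases j _)
      · exact (Sym2.mem_iff.1 hm).elim
          (fun e => absurd (e ▸ hY.subset_names hy.1) hna) (hcases i _)
    exact ⟨haA, (hlevA a haA).symm, hhom.cost_le S rfl⟩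
  · intro _
    have h1 := Finset.card_le_card (hhom.missing_subset S (x := x) rfl)
    have h2 : ((A.addSuccessors R C x Y z).lacking S x).card < (A.lacking S x).card := by
      refine Finset.card_lt_card ((Finset.ssubset_iff_of_subset (hhom.lacking_subset S rfl)).2
        ⟨.geq n R C, ABox.mem_lacking.2 ⟨hI.mem h, n, R, C, rfl, ?_⟩, fun hmem => ?_⟩)
      · rintro ⟨Y', hY', hn'⟩
        exact absurd (hmax Y' hY') (by omega)
      · obtain ⟨-, n', R', C', e, hno⟩ := ABox.mem_lacking.1 hmem
        cases e
        exact hno (ABox.addSuccessors_distinctInstances hY hz hfresh)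
    simp only [ABox.cost]
    omega

theorem ABox.IsSucc.mem_names {A : ABox} {R : Role} {x y : ℕ} (h : A.IsSucc R x y) :
    y ∈ A.names := by
  unfold ABox.IsSucc at h
  have hne := R.chain_ne_nil
  generalize R.chain = l at h hne
  induction l generalizing x with
  | nil => exact absurd rfl hne
  | cons r l ih =>
    obtain ⟨z, hz, h⟩ := h
    cases l with
    | nil => cases h; exact ABox.mem_names.2 ⟨_, hz, .inr rfl⟩
    | cons r' l => exact ih h (by simp)

/-- Every rule application lowers the level cost. -/
theorem Invariant.step {S : Finset NNF} {d : ℕ} {A A' : ABox} {lev : ℕ → ℕ}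
    (hI : Invariant S d A lev) (hS : IsRuleClosed S) (h : A.Step A') :
    ∃ lev', Invariant S d A' lev' ∧ A'.levelCost S d lev' < A.levelCost S d lev := by
  classical
  obtain ⟨T, hT, hA'⟩ := h
  cases hT with
  | and C D x h hn =>
    rw [Set.mem_singleton_iff.1 hA']
    have hdepth := hI.depth h
    simp only [NNF.depth] at hdepth
    obtain ⟨hCS, hDS⟩ := hS.and (hI.mem h)
    have hE : ∃ E ∈ ({C, D} : Finset NNF), Assertion.concept E x ∉ A := by
      by_contra! hall
      exact hn (by simpa [Finset.insert_subset_iff] using hall)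
    obtain ⟨E, hE, hEA⟩ := hE
    have := hI.add_concepts (ABox.mem_names_of_concept h) {C, D} (by
      intro F hF
      rw [Finset.mem_insert, Finset.mem_singleton] at hF
      rcases hF with rfl | rfl
      · exact ⟨hCS, by omega⟩
      · exact ⟨hDS, by omega⟩) hE hEA
    rw [Finset.image_insert, Finset.image_singleton] at this
    exact ⟨lev, this⟩
  | or C D x h hC hD =>
    have hdepth := hI.depth h
    simp only [NNF.depth] at hdepth
    have hx := ABox.mem_names_of_concept h
    rcases hA' with rfl | rfl
    · exact ⟨lev, hI.add_concept hx (hS.or (hI.mem h)).1 (by omega) hC⟩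
    · exact ⟨lev, hI.add_concept hx (hS.or (hI.mem h)).2 (by omega) hD⟩
  | geq n R C x Y z h hY hmax hn hz hfresh =>
    rw [Set.mem_singleton_iff.1 hA']
    refine hI.addSuccessors hS h hY hmax hn hz fun i j hm => ?_
    obtain ⟨s, hs, hm⟩ := ABox.mem_names.1 hm
    exact hfresh i j s hs hm
  | leq n R C x Y h hY hn hne =>
    obtain ⟨y, hy, y', hy', hyy', hne, rfl⟩ := hA'
    have h1 := hI.lev_of_isSucc (hY y hy).1
    have h2 := hI.lev_of_isSucc (hY y' hy').1
    have hdepth := hI.depth h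
    simp only [NNF.depth] at hdepth
    exact ⟨lev, hI.replace (ABox.mem_names_of_concept (hY y hy).2)
      (ABox.mem_names_of_concept (hY y' hy').2) (h1.trans h2.symm) (by omega) hyy' hne⟩
  | choose n R C x y h hy hC hC' =>
    have hl := hI.lev_of_isSucc hy
    have hm : C ∈ S ∧ C.neg ∈ S := h.elim (fun h => hS.geq (hI.mem h)) fun h => hS.leq (hI.mem h)
    have hdepth : lev x + (R.chain.length + C.depth) ≤ d :=
      h.elim (fun h => hI.depth h) fun h => hI.depth h
    have hneg := C.depth_neg_le
    rcases hA' with rfl | rfl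
    · exact ⟨lev, hI.add_concept hy.mem_names hm.1 (by omega) hC⟩
    · exact ⟨lev, hI.add_concept hy.mem_names hm.2 (by omega) hC'⟩

/-- The level cost takes values in a well-founded order, hence the rules terminate. -/
theorem ABox.acc_step (C₀ : NNF) : Acc (fun A' A => ABox.Step A A') (ABox.init C₀) := by
  obtain ⟨S, hS, hC₀, -⟩ := exists_isRuleClosed C₀
  have main : ∀ (m : Lex (Fin (C₀.depth + 1) → ℕ)) (A : ABox) (lev : ℕ → ℕ),
      Invariant S C₀.depth A lev → A.levelCost S C₀.depth lev = m →
      Acc (fun A' A => ABox.Step A A') A := by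
    intro m
    induction m using WellFoundedLT.induction with
    | _ m ih =>
      rintro A lev hI rfl
      refine ⟨_, fun A' h => ?_⟩
      obtain ⟨lev', hI', hlt⟩ := hI.step hS h
      exact ih _ hlt A' lev' hI' rfl
  refine main _ _ (fun _ => 0) ⟨?_, ?_, ?_⟩ rfl
  · simp [ABox.init]
  · simpa [ABox.init] using hC₀
  · intro C x h
    simp only [ABox.init, Finset.mem_singleton, Assertion.concept.injEq] at h
    rw [h.1]
    omega

theorem not_exists_infinite_run (C₀ : NNF) :
    ¬ ∃ A : ℕ → ABox, A 0 = ABox.init C₀ ∧ ∀ i, ABox.Step (A i) (A (i + 1)) := by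
  rintro ⟨A, h0, hA⟩
  have main : ∀ B, Acc (fun A' A => ABox.Step A A') B → ∀ i, A i ≠ B := by
    intro B hB
    induction hB with
    | intro B _ ih =>
      rintro i rfl
      exact ih _ (hA i) (i + 1) rfl
  exact main _ (ABox.acc_step C₀) 0 h0

/-! ### Correctness of the algorithm -/

theorem accepts_iff_satisfiable {σ : ABox → Set ABox} (hσ : IsStrategy σ) (C : Concept) :
    Accepts σ C.nnf ↔ C.Satisfiable.{u} := by
  have hstep : ∀ {A A'}, StepBy σ A A' → ABox.Step A A' := fun h => ⟨_, hσ _ h.1, h.2⟩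
  constructor
  · rintro ⟨A, h, hA, hc⟩
    exact satisfiable_of_complete (Relation.ReflTransGen.mono (fun _ _ => hstep) _ _ h) hA hc
  · rintro ⟨Δ, -, I, x, hx⟩
    have main : ∀ A, Acc (fun A' A => ABox.Step A A') A → ∀ π, A.Holds I π →
        ∃ A', Relation.ReflTransGen (StepBy σ) A A' ∧ A'.Complete ∧ ¬ A'.Clash := by
      intro A hacc
      induction hacc with
      | intro A _ ih =>
        intro π hπ
        by_cases hA : A.Complete
        · exact ⟨A, .refl, hA, hπ.not_clash⟩
        · obtain ⟨A', hA', π', hπ'⟩ := hπ.exists_mem_rule (hσ A hA)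
          obtain ⟨B, hB, h⟩ := ih A' (hstep ⟨hA, hA'⟩) π' hπ'
          exact ⟨B, .head ⟨hA, hA'⟩ hB, h⟩
    refine main _ (ABox.acc_step _) (fun _ => x) fun s hs => ?_
    rw [Finset.mem_singleton.1 hs, Assertion.Holds, Concept.interp_nnf]
    exact hx

/-! ### Small models -/

/-- The unravelling of an interpretation into levels: every role leads to the next level. -/
def Interp.unravel {Δ : Type u} (I : Interp Δ) : Interp (Δ × ℕ) where
  concept a := {x | x.1 ∈ I.concept a}
  role r x y := I.role r x.1 y.1 ∧ y.2 = x.2 + 1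

theorem Role.interp_unravel {Δ : Type u} (I : Interp Δ) (R : Role) (x y : Δ × ℕ) :
    R.interp I.unravel x y ↔ R.interp I x.1 y.1 ∧ y.2 = x.2 + R.chain.length := by
  induction R generalizing x y with
  | atom r => rfl
  | comp R S hR hS =>
    simp only [Role.interp, hR, hS, Role.chain, List.length_append]
    constructor
    · rintro ⟨z, ⟨h1, h2⟩, h3, h4⟩
      exact ⟨⟨z.1, h1, h3⟩, by omega⟩
    · rintro ⟨⟨z, h1, h3⟩, h4⟩
      exact ⟨(z, x.2 + R.chain.length), ⟨h1, rfl⟩, h3, by rw [h4]; simp only; omega⟩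

theorem Interp.encard_unravel {Δ : Type u} (I : Interp Δ) (R : Role) (x : Δ × ℕ) (P : Set Δ) :
    {j | R.interp I.unravel x j ∧ j.1 ∈ P}.encard = {j | R.interp I x.1 j ∧ j ∈ P}.encard := by
  rw [← (Prod.mk_left_injective (x.2 + R.chain.length)).encard_image {j | R.interp I x.1 j ∧ j ∈ P}]
  congr 1
  ext ⟨j, k⟩
  simp only [Role.interp_unravel, Set.mem_ofPred_eq, Set.mem_image, Prod.mk.injEq]
  constructor
  · rintro ⟨⟨h1, h2⟩, h3⟩
    exact ⟨j, ⟨h1, h3⟩, rfl, h2.symm⟩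
  · rintro ⟨j, ⟨h1, h3⟩, rfl, rfl⟩
    exact ⟨⟨h1, rfl⟩, h3⟩

theorem Concept.interp_unravel {Δ : Type u} (I : Interp Δ) (C : Concept) (x : Δ × ℕ) :
    x ∈ C.interp I.unravel ↔ x.1 ∈ C.interp I := by
  induction C generalizing x with
  | top => simp [Concept.interp]
  | bot => simp [Concept.interp]
  | atom a => rfl
  | not C hC => simp [Concept.interp, hC]
  | and C D hC hD => simp [Concept.interp, hC, hD]
  | or C D hC hD => simp [Concept.interp, hC, hD]
  | all R C hC => simp [Concept.interp, hC, Role.interp_unravel]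
  | ex R C hC => simp [Concept.interp, hC, Role.interp_unravel]
  | ge n R =>
    have := I.encard_unravel R x Set.univ
    simp only [Set.mem_univ, and_true] at this
    simp only [Concept.interp, Set.mem_ofPred_eq, this]
  | le n R =>
    have := I.encard_unravel R x Set.univ
    simp only [Set.mem_univ, and_true] at this
    simp only [Concept.interp, Set.mem_ofPred_eq, this]
  | geq n R C hC => simp only [Concept.interp, Set.mem_ofPred_eq, hC, I.encard_unravel R x]
  | leq n R C hC => simp only [Concept.interp, Set.mem_ofPred_eq, hC, I.encard_unravel R x]

/-- The interpretation in which only the role edges between elements of `S` are kept. The other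
elements stay in the domain, but are isolated. -/
def Interp.restrict {X : Type u} (J : Interp X) (S : Set X) : Interp X where
  concept := J.concept
  role r x y := J.role r x y ∧ x ∈ S ∧ y ∈ S

theorem Role.interp_of_restrict {X : Type u} {J : Interp X} {S : Set X} {R : Role} {x y : X}
    (h : R.interp (J.restrict S) x y) : R.interp J x y ∧ x ∈ S ∧ y ∈ S := by
  induction R generalizing x y with
  | atom r => exact h
  | comp R T hR hT =>
    obtain ⟨z, h1, h2⟩ := h
    exact ⟨⟨z, (hR h1).1, (hT h2).1⟩, (hR h1).2.1, (hT h2).2.2⟩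

theorem Role.chain_length_le (R : Role) : R.chain.length ≤ R.toNat + 1 := by
  induction R with
  | atom r => simp [Role.chain]
  | comp R S hR hS =>
    have := Nat.add_le_pair R.toNat S.toNat
    simp only [Role.chain, Role.toNat, List.length_append]
    omega

/-- All roles lead from one level to the next one. -/
def Interp.IsLevelled {X : Type u} (J : Interp X) (lev : X → ℕ) : Prop :=
  ∀ r x y, J.role r x y → lev y = lev x + 1

theorem Interp.IsLevelled.lev_eq {X : Type u} {J : Interp X} {lev : X → ℕ}
    (h : J.IsLevelled lev) {R : Role} {x y : X} (hR : R.interp J x y) :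
    lev y = lev x + R.chain.length := by
  induction R generalizing x y with
  | atom r => exact h r x y hR
  | comp R T hR' hT' =>
    obtain ⟨z, h1, h2⟩ := hR
    rw [hT' h2, hR' h1, Role.chain, List.length_append]
    omega

/-- An `R`-edge is witnessed by the points of a path, all of which lie above the start. -/
theorem Interp.IsLevelled.exists_path {X : Type u} {J : Interp X} {lev : X → ℕ}
    (h : J.IsLevelled lev) {R : Role} {x y : X} (hR : R.interp J x y) :
    ∃ W : Finset X, W.card ≤ R.chain.length ∧ (∀ w ∈ W, lev x < lev w) ∧
      ∀ S : Set X, x ∈ S → ↑W ⊆ S → R.interp (J.restrict S) x y := by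
  classical
  obtain ⟨f, rfl, rfl, hf⟩ := (J.reaches_iff_exists_path _ _ _).1
    ((R.interp_iff_reaches J _ _).1 hR)
  refine ⟨(Finset.range R.chain.length).image fun i => f (i + 1), ?_, ?_, ?_⟩
  · exact Finset.card_image_le.trans_eq (Finset.card_range _)
  · intro w hw
    obtain ⟨i, hi, rfl⟩ := Finset.mem_image.1 hw
    rw [Finset.mem_range] at hi
    clear hw
    induction i with
    | zero => rw [h _ _ _ (hf 0 hi)]; omega
    | succ i ih =>
      rw [h _ _ _ (hf (i + 1) hi)]
      exact Nat.lt_succ_of_lt (ih (Nat.lt_of_succ_lt hi))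
  · intro S hx hW
    have hmem : ∀ i ≤ R.chain.length, f i ∈ S := by
      rintro (_ | i) hi
      · exact hx
      · exact hW (Finset.mem_coe.2 (Finset.mem_image.2 ⟨i, Finset.mem_range.2 hi, rfl⟩))
    refine (R.interp_iff_reaches _ _ _).2 ((Interp.reaches_iff_exists_path _ _ _ _).2
      ⟨f, rfl, rfl, fun i hi => ⟨hf i hi, hmem i hi.le, hmem (i + 1) hi⟩⟩)

/-- Up to the threshold `N`, the number of `R`-successors in `P` is witnessed by
a finite set of bounded size. -/
theorem Interp.IsLevelled.exists_witnesses {X : Type u} {J : Interp X} {lev : X → ℕ}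
    (h : J.IsLevelled lev) (R : Role) (P : Set X) (N : ℕ) (x : X) :
    ∃ W : Finset X, W.card ≤ N * R.chain.length ∧ (∀ w ∈ W, lev x < lev w) ∧
      ∀ S : Set X, x ∈ S → ↑W ⊆ S →
        min (N : ℕ∞) {y | R.interp J x y ∧ y ∈ P}.encard ≤
          {y | R.interp (J.restrict S) x y ∧ y ∈ P}.encard := by
  classical
  obtain ⟨T, hT, hTN⟩ := Set.exists_subset_encard_eq
    (min_le_right (N : ℕ∞) {y | R.interp J x y ∧ y ∈ P}.encard)
  have hle : T.encard ≤ N := hTN ▸ min_le_left _ _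
  have hfin : T.Finite := Set.finite_of_encard_le_coe hle
  lift T to Finset X using hfin
  rw [Set.encard_coe_eq_coe_finsetCard, Nat.cast_le] at hle
  have hpath : ∀ y : X, ∃ W : Finset X, y ∈ T → W.card ≤ R.chain.length ∧
      (∀ w ∈ W, lev x < lev w) ∧
      ∀ S : Set X, x ∈ S → ↑W ⊆ S → R.interp (J.restrict S) x y := by
    intro y
    by_cases hy : y ∈ T
    · obtain ⟨W, hW⟩ := h.exists_path (hT hy).1
      exact ⟨W, fun _ => hW⟩
    · exact ⟨∅, fun hy' => absurd hy' hy⟩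
  choose W hW using hpath
  refine ⟨T.biUnion W, ?_, ?_, ?_⟩
  · exact (Finset.card_biUnion_le_card_mul T W _ fun y hy => (hW y hy).1).trans
      (Nat.mul_le_mul_right _ hle)
  · intro w hw
    obtain ⟨y, hy, hw⟩ := Finset.mem_biUnion.1 hw
    exact (hW y hy).2.1 w hw
  · intro S hx hS
    rw [← hTN]
    refine Set.encard_le_encard fun y hy => ⟨(hW y hy).2.2 S hx fun w hw => hS ?_, (hT hy).2⟩
    exact Finset.mem_coe.2 (Finset.mem_biUnion.2 ⟨y, hy, hw⟩)

/-- For all roles and concepts with code at most `c`, the restriction to `S`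
preserves, up to the threshold `c + 1`, the number of role successors of `x` inside and
outside the extension of the concept in `J`. -/
def Interp.Preserves {X : Type u} (J : Interp X) (c : ℕ) (S : Set X) (x : X) : Prop :=
  ∀ R : Role, R.toNat ≤ c → ∀ C : Concept, C.toNat ≤ c →
    ∀ P ∈ ({C.interp J, (C.interp J)ᶜ} : Set (Set X)),
      min ((c + 1 : ℕ) : ℕ∞) {y | R.interp J x y ∧ y ∈ P}.encard ≤
        {y | R.interp (J.restrict S) x y ∧ y ∈ P}.encard

/-- A bound for the number of elements that have to be kept for the sake of one element. -/
def witnessBound (c : ℕ) : ℕ := 2 * (c + 1) ^ 4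

theorem Interp.IsLevelled.exists_preserves {X : Type u} {J : Interp X} {lev : X → ℕ}
    (h : J.IsLevelled lev) (c : ℕ) (x : X) :
    ∃ W : Finset X, W.card ≤ witnessBound c ∧ (∀ w ∈ W, lev x < lev w) ∧
      ∀ S : Set X, x ∈ S → ↑W ⊆ S → J.Preserves c S x := by
  classical
  choose W hW1 hW2 hW3 using fun (R : Role) (P : Set X) => h.exists_witnesses R P (c + 1) x
  let s (p : ℕ × ℕ) : Finset X :=
    W (Role.ofNat p.1) ((Concept.ofNat p.2).interp J) ∪
      W (Role.ofNat p.1) ((Concept.ofNat p.2).interp J)ᶜ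
  refine ⟨(Finset.range (c + 1) ×ˢ Finset.range (c + 1)).biUnion s, ?_, ?_, ?_⟩
  · refine (Finset.card_biUnion_le_card_mul _ _ (2 * ((c + 1) * (c + 1))) ?_).trans ?_
    · rintro ⟨p, q⟩ hp
      rw [Finset.mem_product, Finset.mem_range, Finset.mem_range] at hp
      have hle : ∀ P, (W (Role.ofNat p) P).card ≤ (c + 1) * (c + 1) := fun P =>
        (hW1 _ P).trans (Nat.mul_le_mul_left _ ((Role.chain_length_le _).trans
          (by rw [Role.toNat_ofNat]; exact hp.1)))
      refine (Finset.card_union_le _ _).trans ?_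
      have h1 := hle ((Concept.ofNat q).interp J)
      have h2 := hle ((Concept.ofNat q).interp J)ᶜ
      dsimp only
      omega
    · rw [Finset.card_product, Finset.card_range, witnessBound]
      apply le_of_eq
      ring
  · intro w hw
    obtain ⟨p, -, hw⟩ := Finset.mem_biUnion.1 hw
    exact (Finset.mem_union.1 hw).elim (hW2 _ _ w) (hW2 _ _ w)
  · intro S hx hS R hR C hC P hP
    refine hW3 R P S hx fun w hw => hS (Finset.mem_coe.2 (Finset.mem_biUnion.2
      ⟨(R.toNat, C.toNat), ?_, ?_⟩))
    · simp only [Finset.mem_product, Finset.mem_range]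
      omega
    · simp only [s, Role.ofNat_toNat, Concept.ofNat_toNat, Finset.mem_union]
      rcases hP with rfl | rfl
      · exact Or.inl hw
      · exact Or.inr hw

/-- The number of role steps that a concept can speak about. -/
def Concept.depth : Concept → ℕ
  | .not C => C.depth
  | .and C D => max C.depth D.depth
  | .or C D => max C.depth D.depth
  | .all R C => R.chain.length + C.depth
  | .ex R C => R.chain.length + C.depth
  | .ge _ R => R.chain.length
  | .le _ R => R.chain.length
  | .geq _ R C => R.chain.length + C.depth
  | .leq _ R C => R.chain.length + C.depth
  | _ => 0

theorem Concept.depth_le_toNat (C : Concept) : C.depth ≤ C.toNat := by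
  have hp := Nat.add_le_pair
  have hR := Role.chain_length_le
  induction C with
  | top | bot | atom => simp [Concept.depth]
  | not C hC => simp only [Concept.depth, Concept.toNat]; omega
  | and C D hC hD | or C D hC hD =>
    have := hp C.toNat D.toNat
    simp only [Concept.depth, Concept.toNat]; omega
  | all R C hC | ex R C hC =>
    have := hp R.toNat C.toNat
    have := hR R
    simp only [Concept.depth, Concept.toNat]; omega
  | ge n R | le n R =>
    have := hp n R.toNat
    have := hR R
    simp only [Concept.depth, Concept.toNat]; omega
  | geq n R C hC | leq n R C hC =>
    have := hp n (Nat.pair R.toNat C.toNat)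
    have := hp R.toNat C.toNat
    have := hR R
    simp only [Concept.depth, Concept.toNat]; omega

/-- The set of elements kept preserves the truth of all concepts with code at most `c`, as far
as these do not look beyond level `d`. -/
theorem Interp.IsLevelled.mem_interp_restrict_iff {X : Type u} {J : Interp X} {lev : X → ℕ}
    (h : J.IsLevelled lev) {c d : ℕ} {S : Set X}
    (hS : ∀ x ∈ S, lev x ≤ d → J.Preserves c S x) (C : Concept) (hC : C.toNat ≤ c) {x : X}
    (hx : x ∈ S) (hd : lev x + C.depth ≤ d) :
    x ∈ C.interp (J.restrict S) ↔ x ∈ C.interp J := by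
  -- Above the level of `x`, the truth of `C` may be evaluated in `J`.
  have succ : ∀ (R : Role) (C : Concept) (x : X), lev x + (R.chain.length + C.depth) ≤ d →
      (∀ y ∈ S, lev y + C.depth ≤ d → (y ∈ C.interp (J.restrict S) ↔ y ∈ C.interp J)) →
      ∀ y, R.interp (J.restrict S) x y → (y ∈ C.interp (J.restrict S) ↔ y ∈ C.interp J) := by
    intro R C x hd hC y hy
    obtain ⟨h1, -, h3⟩ := Role.interp_of_restrict hy
    exact hC y h3 (by rw [h.lev_eq h1]; omega)
  have le : ∀ (R : Role) (P : Set X) (x : X),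
      {y | R.interp (J.restrict S) x y ∧ y ∈ P}.encard ≤ {y | R.interp J x y ∧ y ∈ P}.encard :=
    fun R P x => Set.encard_le_encard fun y hy => ⟨(Role.interp_of_restrict hy.1).1, hy.2⟩
  have geq : ∀ (n : ℕ) (R : Role) (C : Concept) (x : X), n ≤ c → R.toNat ≤ c → C.toNat ≤ c →
      x ∈ S → lev x ≤ d → ∀ P ∈ ({C.interp J, (C.interp J)ᶜ} : Set (Set X)),
      ((n : ℕ∞) ≤ {y | R.interp (J.restrict S) x y ∧ y ∈ P}.encard ↔
        (n : ℕ∞) ≤ {y | R.interp J x y ∧ y ∈ P}.encard) := by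
    intro n R C x hn hR hC hx hd P hP
    refine ⟨fun h => h.trans (le R P x), fun h => ?_⟩
    refine le_trans (le_min ?_ h) (hS x hx hd R hR C hC P hP)
    exact_mod_cast hn.trans (Nat.le_succ c)
  have leq : ∀ (n : ℕ) (R : Role) (C : Concept) (x : X), n ≤ c → R.toNat ≤ c → C.toNat ≤ c →
      x ∈ S → lev x ≤ d →
      ({y | R.interp (J.restrict S) x y ∧ y ∈ C.interp J}.encard ≤ (n : ℕ∞) ↔
        {y | R.interp J x y ∧ y ∈ C.interp J}.encard ≤ (n : ℕ∞)) := by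
    intro n R C x hn hR hC hx hd
    refine ⟨fun h => ?_, fun h => (le R _ x).trans h⟩
    have h1 := (hS x hx hd R hR C hC _ (Or.inl rfl)).trans h
    rcases min_le_iff.1 h1 with h1 | h1
    · rw [Nat.cast_le] at h1
      omega
    · exact h1
  have hp := Nat.add_le_pair
  induction C generalizing x with
  | top => rfl
  | bot => rfl
  | atom a => rfl
  | not C ih =>
    simp only [Concept.depth, Concept.toNat] at hd hC
    simp only [Concept.interp, Set.mem_compl_iff, ih (by omega) hx hd]
  | and C D ihC ihD =>
    simp only [Concept.depth, Concept.toNat] at hd hC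
    have := hp C.toNat D.toNat
    simp only [Concept.interp, Set.mem_inter_iff, ihC (by omega) hx (by omega),
      ihD (by omega) hx (by omega)]
  | or C D ihC ihD =>
    simp only [Concept.depth, Concept.toNat] at hd hC
    have := hp C.toNat D.toNat
    simp only [Concept.interp, Set.mem_union, ihC (by omega) hx (by omega),
      ihD (by omega) hx (by omega)]
  | all R C ih =>
    simp only [Concept.depth, Concept.toNat] at hd hC
    have := hp R.toNat C.toNat
    have hs := succ R C x hd fun y hy hd => ih (by omega) hy hd
    have := geq 1 R C x (by omega) (by omega) (by omega) hx (by omega) _ (Or.inr rfl)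
    simp only [Nat.cast_one, Set.one_le_encard_iff_nonempty, Set.Nonempty, Set.mem_ofPred_eq,
      Set.mem_compl_iff] at this
    simp only [Concept.interp, Set.mem_ofPred_eq]
    rw [← not_iff_not]
    push Not
    rw [← this]
    exact exists_congr fun y => and_congr_right fun hy => not_congr (hs y hy)
  | ex R C ih =>
    simp only [Concept.depth, Concept.toNat] at hd hC
    have := hp R.toNat C.toNat
    have hs := succ R C x hd fun y hy hd => ih (by omega) hy hd
    have := geq 1 R C x (by omega) (by omega) (by omega) hx (by omega) _ (Or.inl rfl)
    simp only [Nat.cast_one, Set.one_le_encard_iff_nonempty, Set.Nonempty,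
      Set.mem_ofPred_eq] at this
    simp only [Concept.interp, Set.mem_ofPred_eq]
    rw [← this]
    exact exists_congr fun y => and_congr_right fun hy => hs y hy
  | ge n R =>
    simp only [Concept.depth, Concept.toNat] at hd hC
    have := hp n R.toNat
    have := geq n R .top x (by omega) (by omega) (by simp [Concept.toNat]) hx (by omega) _
      (Or.inl rfl)
    simpa [Concept.interp] using this
  | le n R =>
    simp only [Concept.depth, Concept.toNat] at hd hC
    have := hp n R.toNat
    have := leq n R .top x (by omega) (by omega) (by simp [Concept.toNat]) hx (by omega)
    simpa [Concept.interp] using this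
  | geq n R C ih =>
    simp only [Concept.depth, Concept.toNat] at hd hC
    have := hp n (Nat.pair R.toNat C.toNat)
    have := hp R.toNat C.toNat
    have hs := succ R C x hd fun y hy hd => ih (by omega) hy hd
    have := geq n R C x (by omega) (by omega) (by omega) hx (by omega) _ (Or.inl rfl)
    simp only [Concept.interp, Set.mem_ofPred_eq]
    rw [← this]
    have he : {y | R.interp (J.restrict S) x y ∧ y ∈ C.interp (J.restrict S)} =
        {y | R.interp (J.restrict S) x y ∧ y ∈ C.interp J} :=
      Set.ext fun y => and_congr_right (hs y)
    rw [he]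
  | leq n R C ih =>
    simp only [Concept.depth, Concept.toNat] at hd hC
    have := hp n (Nat.pair R.toNat C.toNat)
    have := hp R.toNat C.toNat
    have hs := succ R C x hd fun y hy hd => ih (by omega) hy hd
    have := leq n R C x (by omega) (by omega) (by omega) hx (by omega)
    simp only [Concept.interp, Set.mem_ofPred_eq]
    rw [← this]
    have he : {y | R.interp (J.restrict S) x y ∧ y ∈ C.interp (J.restrict S)} =
        {y | R.interp (J.restrict S) x y ∧ y ∈ C.interp J} :=
      Set.ext fun y => and_congr_right (hs y)
    rw [he]

/-- Adding witnesses `d + 1` times is enough to provide all elements of the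
first `d` levels with witnesses, since witnesses lie on higher levels. -/
theorem exists_closed_finset {X : Type u} (lev : X → ℕ) (W : X → Finset X) {w : ℕ}
    (hw : ∀ x, (W x).card ≤ w) (hlev : ∀ x, ∀ y ∈ W x, lev x < lev y) (x₀ : X) (d : ℕ) :
    ∃ S : Finset X, S.card ≤ (1 + w) ^ (d + 1) ∧ x₀ ∈ S ∧
      ∀ x ∈ S, lev x ≤ d → W x ⊆ S := by
  classical
  let S : ℕ → Finset X := fun i => Nat.rec {x₀} (fun _ T => T ∪ T.biUnion W) i
  have hsucc : ∀ i, S (i + 1) = S i ∪ (S i).biUnion W := fun _ => rfl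
  have hmono : Monotone S := monotone_nat_of_le_succ fun i => by
    rw [hsucc]; exact Finset.subset_union_left
  have hstep : ∀ i, ∀ x ∈ S i, W x ⊆ S (i + 1) := fun i x hx y hy => by
    rw [hsucc]
    exact Finset.mem_union_right _ (Finset.mem_biUnion.2 ⟨x, hx, hy⟩)
  have hS : ∀ i, ∀ x ∈ S i, x ∈ S (lev x) := by
    intro i
    induction i with
    | zero => exact fun x hx => hmono (Nat.zero_le _) hx
    | succ i ih =>
      intro x hx
      rw [hsucc, Finset.mem_union] at hx
      rcases hx with hx | hx
      · exact ih x hx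
      · obtain ⟨y, hy, hx⟩ := Finset.mem_biUnion.1 hx
        exact hmono (hlev y x hx) (hstep _ y (ih y hy) hx)
  have hcard : ∀ i, (S i).card ≤ (1 + w) ^ i := by
    intro i
    induction i with
    | zero => simp [S]
    | succ i ih =>
      rw [hsucc]
      calc _ ≤ (S i).card + (S i).card * w := (Finset.card_union_le _ _).trans
            (Nat.add_le_add_left (Finset.card_biUnion_le_card_mul _ _ _ fun x _ => hw x) _)
        _ = (S i).card * (1 + w) := by ring
        _ ≤ _ := by rw [pow_succ]; exact Nat.mul_le_mul_right _ ih
  exact ⟨S (d + 1), hcard (d + 1), hmono (Nat.zero_le (d + 1)) (Finset.mem_singleton_self x₀ : x₀ ∈ S 0),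
    fun x hx hd => hstep d x (hmono hd (hS (d + 1) x hx))⟩

/-- A bound for the size of models of a satisfiable concept with code `c`. -/
def sizeBound (c : ℕ) : ℕ := (1 + witnessBound c) ^ (c + 1)

theorem Concept.Satisfiable.exists_small_model {C : Concept} (hC : C.Satisfiable.{u}) :
    ∃ (X : Type u) (J : Interp X) (S : Finset X), S.card ≤ sizeBound C.toNat ∧
      (∀ r x y, J.role r x y → x ∈ S ∧ y ∈ S) ∧ ∃ x ∈ S, x ∈ C.interp J := by
  obtain ⟨Δ, -, I, x, hx⟩ := hC
  have hJ : I.unravel.IsLevelled Prod.snd := fun r x y h => h.2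
  choose W hW1 hW2 hW3 using hJ.exists_preserves C.toNat
  obtain ⟨S, hS1, hS2, hS3⟩ := exists_closed_finset Prod.snd W hW1 hW2 (x, 0) C.toNat
  refine ⟨Δ × ℕ, I.unravel.restrict S, S, hS1, fun r x y h => h.2, (x, 0), hS2, ?_⟩
  rw [hJ.mem_interp_restrict_iff (d := C.toNat)
    (fun y hy hd => hW3 y S hy (Finset.coe_subset.2 (hS3 y hy hd))) C le_rfl hS2
    (by simpa using C.depth_le_toNat), Concept.interp_unravel]
  exact hx

/-! ### Primitive recursion -/

section Primrec

variable {α : Type*} [Primcodable α]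

theorem primrecPred_forall_lt {f : α → ℕ} {p : α → ℕ → Prop} (hf : Primrec f)
    (hp : PrimrecPred fun a : α × ℕ => p a.1 a.2) : PrimrecPred fun a => ∀ x < f a, p a x :=
  ((PrimrecRel.forall_mem_list (R := fun x a => p a x)
    (hp.comp (f := fun q : ℕ × α => (q.2, q.1)) (Primrec.pair Primrec.snd Primrec.fst))).comp
    (Primrec.list_range.comp hf) Primrec.id).of_eq fun a => by simp

theorem primrecPred_exists_lt {f : α → ℕ} {p : α → ℕ → Prop} (hf : Primrec f)
    (hp : PrimrecPred fun a : α × ℕ => p a.1 a.2) : PrimrecPred fun a => ∃ x < f a, p a x :=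
  ((PrimrecRel.exists_mem_list (R := fun x a => p a x)
    (hp.comp (f := fun q : ℕ × α => (q.2, q.1)) (Primrec.pair Primrec.snd Primrec.fst))).comp
    (Primrec.list_range.comp hf) Primrec.id).of_eq fun a => by simp

theorem primrecPred_imp {p q : α → Prop} (hp : PrimrecPred p) (hq : PrimrecPred q) :
    PrimrecPred fun a => p a → q a :=
  (hp.not.or hq).of_eq fun _ => imp_iff_not_or.symm

theorem primrecPred_iff {p q : α → Prop} (hp : PrimrecPred p) (hq : PrimrecPred q) :
    PrimrecPred fun a => (p a ↔ q a) :=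
  ((primrecPred_imp hp hq).and (primrecPred_imp hq hp)).of_eq fun _ => iff_iff_implies_and_implies.symm

open Classical in
/-- The number of `i < n` with `p i`. -/
noncomputable def countLt (p : ℕ → Prop) (n : ℕ) : ℕ := Nat.count p n

theorem primrec_countLt {f : α → ℕ} {p : α → ℕ → Prop} (hf : Primrec f)
    (hp : PrimrecPred fun a : α × ℕ => p a.1 a.2) : Primrec fun a => countLt (p a) (f a) := by
  classical
  have hite : Primrec fun q : α × ℕ × ℕ => if p q.1 q.2.1 then q.2.2 + 1 else q.2.2 :=
    Primrec.ite (hp.comp (Primrec.pair Primrec.fst (Primrec.fst.comp Primrec.snd)))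
      (Primrec.succ.comp (Primrec.snd.comp Primrec.snd)) (Primrec.snd.comp Primrec.snd)
  refine (Primrec.nat_rec' (f := f) (g := fun _ : α => 0)
    (h := fun a q => if p a q.1 then q.2 + 1 else q.2) hf (Primrec.const 0) hite).of_eq fun a => ?_
  unfold countLt
  induction f a with
  | zero => rfl
  | succ n ih =>
    simp only [Nat.count_succ, ih]
    split_ifs <;> rfl

theorem primrec_pow : Primrec₂ fun m n : ℕ => m ^ n := by
  refine (Primrec.nat_rec' (f := fun p : ℕ × ℕ => p.2) (g := fun _ => 1)
    (h := fun p q => q.2 * p.1) Primrec.snd (Primrec.const 1)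
    (Primrec.nat_mul.comp (Primrec.snd.comp Primrec.snd) (Primrec.fst.comp Primrec.fst))).of_eq ?_
  rintro ⟨m, n⟩
  induction n with
  | zero => rfl
  | succ n ih => simp only [pow_succ, ← ih]

theorem primrecRel_testBit : PrimrecRel fun m i : ℕ => m.testBit i = true :=
  (Primrec.eq.comp (Primrec.nat_mod.comp (Primrec.nat_div.comp Primrec.fst
    (primrec_pow.comp (Primrec.const 2) Primrec.snd)) (Primrec.const 2)) (Primrec.const 1)).of_eq
      fun p => by simp [Nat.testBit_eq_decide_div_mod_eq]

end Primrec

/-! ### Coding of small models -/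

/-- The bit table `T` says that the element `e` is in the extension of the concept with code `p`. -/
def HasMem (T p e : ℕ) : Prop := T.testBit (Nat.pair p e) = true

/-- The bit table `U` says that the pair `(e, f)` is in the role with code `p`. -/
def HasRel (U p e f : ℕ) : Prop := U.testBit (Nat.pair p (Nat.pair e f)) = true

/-- The bit tables `T` and `U` obey the semantic clauses of the concepts and roles with code at
most `c`, over the domain `{0, …, n - 1}`. Extensions of concept and role names are arbitrary, so
that the tables describe both an interpretation and the evaluation of concepts in it. -/
def IsTable (c n T U : ℕ) : Prop :=
  (∀ e < n, HasMem T 0 e ∧ (1 ≤ c → ¬ HasMem T 1 e)) ∧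
  (∀ p < c + 1, ∀ q < c + 1, ∀ e < n, ∀ f < n, 2 * Nat.pair p q + 1 ≤ c →
    (HasRel U (2 * Nat.pair p q + 1) e f ↔ ∃ g < n, HasRel U p e g ∧ HasRel U q g f)) ∧
  (∀ p < c + 1, ∀ e < n, 10 * p + 3 ≤ c → (HasMem T (10 * p + 3) e ↔ ¬ HasMem T p e)) ∧
  (∀ p < c + 1, ∀ q < c + 1, ∀ e < n, 10 * Nat.pair p q + 4 ≤ c →
    (HasMem T (10 * Nat.pair p q + 4) e ↔ HasMem T p e ∧ HasMem T q e)) ∧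
  (∀ p < c + 1, ∀ q < c + 1, ∀ e < n, 10 * Nat.pair p q + 5 ≤ c →
    (HasMem T (10 * Nat.pair p q + 5) e ↔ HasMem T p e ∨ HasMem T q e)) ∧
  (∀ p < c + 1, ∀ q < c + 1, ∀ e < n, 10 * Nat.pair p q + 6 ≤ c →
    (HasMem T (10 * Nat.pair p q + 6) e ↔ ∀ f < n, HasRel U p e f → HasMem T q f)) ∧
  (∀ p < c + 1, ∀ q < c + 1, ∀ e < n, 10 * Nat.pair p q + 7 ≤ c →
    (HasMem T (10 * Nat.pair p q + 7) e ↔ ∃ f < n, HasRel U p e f ∧ HasMem T q f)) ∧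
  (∀ m < c + 1, ∀ p < c + 1, ∀ e < n, 10 * Nat.pair m p + 8 ≤ c →
    (HasMem T (10 * Nat.pair m p + 8) e ↔ m ≤ countLt (fun f => HasRel U p e f) n)) ∧
  (∀ m < c + 1, ∀ p < c + 1, ∀ e < n, 10 * Nat.pair m p + 9 ≤ c →
    (HasMem T (10 * Nat.pair m p + 9) e ↔ countLt (fun f => HasRel U p e f) n ≤ m)) ∧
  (∀ m < c + 1, ∀ p < c + 1, ∀ q < c + 1, ∀ e < n, 10 * Nat.pair m (Nat.pair p q) + 10 ≤ c →
    (HasMem T (10 * Nat.pair m (Nat.pair p q) + 10) e ↔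
      m ≤ countLt (fun f => HasRel U p e f ∧ HasMem T q f) n)) ∧
  (∀ m < c + 1, ∀ p < c + 1, ∀ q < c + 1, ∀ e < n, 10 * Nat.pair m (Nat.pair p q) + 11 ≤ c →
    (HasMem T (10 * Nat.pair m (Nat.pair p q) + 11) e ↔
      countLt (fun f => HasRel U p e f ∧ HasMem T q f) n ≤ m))

/-- A bound for the indices of the bits used in the tables. -/
def tableBound (c : ℕ) : ℕ := (c + (sizeBound c + 1) ^ 2 + 1) ^ 2

/-- A table of bounded size witnesses the satisfiability of the concept with code `c`. -/
def HasTable (c : ℕ) : Prop :=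
  ∃ n < sizeBound c + 1, ∃ T < 2 ^ tableBound c, ∃ U < 2 ^ tableBound c,
    IsTable c n T U ∧ ∃ e < n, HasMem T c e

theorem primrecPred_hasTable : PrimrecPred HasTable := by
  have id' : ∀ {α : Type} [Primcodable α], Primrec fun a : α => a := Primrec.id
  have fst' : ∀ {α β γ : Type} [Primcodable α] [Primcodable β] [Primcodable γ] {f : α → β × γ},
      Primrec f → Primrec fun a => (f a).1 := fun h => Primrec.fst.comp h
  have snd' : ∀ {α β γ : Type} [Primcodable α] [Primcodable β] [Primcodable γ] {f : α → β × γ},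
      Primrec f → Primrec fun a => (f a).2 := fun h => Primrec.snd.comp h
  have add' : ∀ {α : Type} [Primcodable α] {f g : α → ℕ}, Primrec f → Primrec g →
      Primrec fun a => f a + g a := fun h h' => Primrec.nat_add.comp h h'
  have mul' : ∀ {α : Type} [Primcodable α] {f g : α → ℕ}, Primrec f → Primrec g →
      Primrec fun a => f a * g a := fun h h' => Primrec.nat_mul.comp h h'
  have pow' : ∀ {α : Type} [Primcodable α] {f g : α → ℕ}, Primrec f → Primrec g →
      Primrec fun a => f a ^ g a := fun h h' => primrec_pow.comp h h'
  have pair' : ∀ {α : Type} [Primcodable α] {f g : α → ℕ}, Primrec f → Primrec g →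
      Primrec fun a => Nat.pair (f a) (g a) := fun h h' => Primrec₂.natPair.comp h h'
  have le' : ∀ {α : Type} [Primcodable α] {f g : α → ℕ}, Primrec f → Primrec g →
      PrimrecPred fun a => f a ≤ g a := fun h h' => Primrec.nat_le.comp h h'
  have bit' : ∀ {α : Type} [Primcodable α] {f g : α → ℕ}, Primrec f → Primrec g →
      PrimrecPred fun a => (f a).testBit (g a) = true := fun h h' => primrecRel_testBit.comp h h'
  unfold HasTable IsTable HasMem HasRel tableBound sizeBound witnessBound
  repeat with_reducible first
    | exact id'
    | exact Primrec.const _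
    | apply primrecPred_forall_lt
    | apply primrecPred_exists_lt
    | apply PrimrecPred.and
    | apply primrecPred_iff
    | apply PrimrecPred.or
    | apply PrimrecPred.not
    | apply primrecPred_imp
    | apply le'
    | apply bit'
    | apply primrec_countLt
    | apply pair'
    | apply add'
    | apply mul'
    | apply pow'
    | apply fst'
    | apply snd'

theorem encard_lt_and (n : ℕ) (p : ℕ → Prop) :
    {f | f < n ∧ p f}.encard = (countLt p n : ℕ∞) := by
  rw [countLt, Nat.count_eq_card_filter_range, ← Set.encard_coe_eq_coe_finsetCard]
  congr 1
  ext
  simp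

/-- The interpretation described by bit tables; elements from `n` on are isolated. -/
def tableInterp (n T U : ℕ) : Interp ℕ where
  concept a := {e | HasMem T (10 * a + 2) e}
  role r e f := HasRel U (2 * r) e f ∧ e < n ∧ f < n

theorem IsTable.role_interp_iff {c n T U : ℕ} (h : IsTable c n T U) (R : Role) (hR : R.toNat ≤ c)
    (e f : ℕ) : R.interp (tableInterp n T U) e f ↔ HasRel U R.toNat e f ∧ e < n ∧ f < n := by
  induction R generalizing e f with
  | atom r => rfl
  | comp R S ihR ihS =>
    have hp := Nat.add_le_pair R.toNat S.toNat
    simp only [Role.toNat] at hR ⊢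
    simp only [Role.interp, ihR (by omega), ihS (by omega)]
    constructor
    · rintro ⟨g, ⟨h1, h2, h3⟩, h4, -, h5⟩
      exact ⟨(h.2.1 _ (by omega) _ (by omega) _ h2 _ h5 hR).2 ⟨g, h3, h1, h4⟩, h2, h5⟩
    · rintro ⟨h1, h2, h3⟩
      obtain ⟨g, h4, h5, h6⟩ := (h.2.1 _ (by omega) _ (by omega) _ h2 _ h3 hR).1 h1
      exact ⟨g, ⟨h5, h2, h4⟩, h6, h4, h3⟩

theorem IsTable.mem_interp_iff {c n T U : ℕ} (h : IsTable c n T U) (C : Concept)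
    (hC : C.toNat ≤ c) {e : ℕ} (he : e < n) :
    e ∈ C.interp (tableInterp n T U) ↔ HasMem T C.toNat e := by
  classical
  have hr := h.role_interp_iff
  obtain ⟨h1, -, hnot, hand, hor, hall, hex, hge, hle, hgeq, hleq⟩ := h
  have hp := Nat.add_le_pair
  induction C generalizing e with
  | top => exact iff_of_true trivial (h1 e he).1
  | bot => exact iff_of_false id ((h1 e he).2 hC)
  | atom a => rfl
  | not C ih =>
    simp only [Concept.toNat] at hC ⊢
    exact (not_congr (ih (by omega) he)).trans (hnot _ (by omega) _ he hC).symm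
  | and C D ihC ihD =>
    simp only [Concept.toNat] at hC ⊢
    have := hp C.toNat D.toNat
    exact (and_congr (ihC (by omega) he) (ihD (by omega) he)).trans
      (hand _ (by omega) _ (by omega) _ he hC).symm
  | or C D ihC ihD =>
    simp only [Concept.toNat] at hC ⊢
    have := hp C.toNat D.toNat
    exact (or_congr (ihC (by omega) he) (ihD (by omega) he)).trans
      (hor _ (by omega) _ (by omega) _ he hC).symm
  | all R C ih =>
    simp only [Concept.toNat] at hC ⊢
    have := hp R.toNat C.toNat
    rw [hall _ (by omega) _ (by omega) _ he hC, Concept.interp, Set.mem_ofPred_eq]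
    refine forall_congr' fun f => ?_
    rw [hr R (by omega)]
    exact ⟨fun h hf hR => (ih (by omega) hf).1 (h ⟨hR, he, hf⟩),
      fun h hR => (ih (by omega) hR.2.2).2 (h hR.2.2 hR.1)⟩
  | ex R C ih =>
    simp only [Concept.toNat] at hC ⊢
    have := hp R.toNat C.toNat
    rw [hex _ (by omega) _ (by omega) _ he hC, Concept.interp, Set.mem_ofPred_eq]
    refine exists_congr fun f => ?_
    rw [hr R (by omega)]
    exact ⟨fun h => ⟨h.1.2.2, h.1.1, (ih (by omega) h.1.2.2).1 h.2⟩,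
      fun h => ⟨⟨h.2.1, he, h.1⟩, (ih (by omega) h.1).2 h.2.2⟩⟩
  | ge m R =>
    simp only [Concept.toNat] at hC ⊢
    have := hp m R.toNat
    rw [hge _ (by omega) _ (by omega) _ he hC, Concept.interp, Set.mem_ofPred_eq,
      ← Nat.cast_le (α := ℕ∞), ← encard_lt_and]
    simp only [hr R (by omega), he, true_and, and_comm]
  | le m R =>
    simp only [Concept.toNat] at hC ⊢
    have := hp m R.toNat
    rw [hle _ (by omega) _ (by omega) _ he hC, Concept.interp, Set.mem_ofPred_eq,
      ← Nat.cast_le (α := ℕ∞), ← encard_lt_and]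
    simp only [hr R (by omega), he, true_and, and_comm]
  | geq m R C ih =>
    simp only [Concept.toNat] at hC ⊢
    have := hp m (Nat.pair R.toNat C.toNat)
    have := hp R.toNat C.toNat
    rw [hgeq _ (by omega) _ (by omega) _ (by omega) _ he hC, Concept.interp, Set.mem_ofPred_eq,
      ← Nat.cast_le (α := ℕ∞), ← encard_lt_and]
    have hs : {f | R.interp (tableInterp n T U) e f ∧ f ∈ C.interp (tableInterp n T U)} =
        {f | f < n ∧ HasRel U R.toNat e f ∧ HasMem T C.toNat f} := by
      ext f
      simp only [Set.mem_ofPred_eq, hr R (by omega)]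
      exact ⟨fun h => ⟨h.1.2.2, h.1.1, (ih (by omega) h.1.2.2).1 h.2⟩,
        fun h => ⟨⟨h.2.1, he, h.1⟩, (ih (by omega) h.1).2 h.2.2⟩⟩
    rw [hs]
  | leq m R C ih =>
    simp only [Concept.toNat] at hC ⊢
    have := hp m (Nat.pair R.toNat C.toNat)
    have := hp R.toNat C.toNat
    rw [hleq _ (by omega) _ (by omega) _ (by omega) _ he hC, Concept.interp, Set.mem_ofPred_eq,
      ← Nat.cast_le (α := ℕ∞), ← encard_lt_and]
    have hs : {f | R.interp (tableInterp n T U) e f ∧ f ∈ C.interp (tableInterp n T U)} =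
        {f | f < n ∧ HasRel U R.toNat e f ∧ HasMem T C.toNat f} := by
      ext f
      simp only [Set.mem_ofPred_eq, hr R (by omega)]
      exact ⟨fun h => ⟨h.1.2.2, h.1.1, (ih (by omega) h.1.2.2).1 h.2⟩,
        fun h => ⟨⟨h.2.1, he, h.1⟩, (ih (by omega) h.1).2 h.2.2⟩⟩
    rw [hs]

theorem exists_bits (m : ℕ) (p : ℕ → Prop) :
    ∃ T < 2 ^ m, ∀ i < m, (T.testBit i = true ↔ p i) := by
  classical
  refine ⟨Nat.ofBits fun i : Fin m => decide (p i), Nat.ofBits_lt_two_pow _, fun i hi => ?_⟩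
  rw [Nat.testBit_ofBits_lt _ _ hi]
  simp

/-- An interpretation whose edges stay in the finite set enumerated by `v` is described by
tables. -/
theorem isTable_of_interp {X : Type u} {J : Interp X} {c n T U : ℕ} {v : ℕ → X}
    (hv : Set.InjOn v (Set.Iio n)) (hJ : ∀ r x y, J.role r x y → y ∈ v '' Set.Iio n)
    (hT : ∀ C : Concept, C.toNat ≤ c → ∀ e < n, (HasMem T C.toNat e ↔ v e ∈ C.interp J))
    (hU : ∀ R : Role, R.toNat ≤ c → ∀ e < n, ∀ f < n,
      (HasRel U R.toNat e f ↔ R.interp J (v e) (v f))) :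
    IsTable c n T U := by
  classical
  have hC : ∀ p, ∃ C : Concept, C.toNat = p := fun p => ⟨_, Concept.toNat_ofNat p⟩
  have hR : ∀ p, ∃ R : Role, R.toNat = p := fun p => ⟨_, Role.toNat_ofNat p⟩
  have hJ' : ∀ (R : Role) {x y : X}, R.interp J x y → ∃ f < n, v f = y := by
    intro R
    induction R with
    | atom r => exact fun h => hJ r _ _ h
    | comp R S _ ih => exact fun ⟨z, _, h⟩ => ih h
  have hcount : ∀ (R : Role) (e : ℕ) (P : Set X),
      {y | R.interp J (v e) y ∧ y ∈ P}.encard =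
        (countLt (fun f => R.interp J (v e) (v f) ∧ v f ∈ P) n : ℕ∞) := by
    intro R e P
    rw [← encard_lt_and, ← (hv.mono fun f hf => hf.1 :
      Set.InjOn v {f | f < n ∧ R.interp J (v e) (v f) ∧ v f ∈ P}).encard_image]
    congr 1
    ext y
    constructor
    · rintro ⟨h1, h2⟩
      obtain ⟨f, hf, rfl⟩ := hJ' R h1
      exact ⟨f, ⟨hf, h1, h2⟩, rfl⟩
    · rintro ⟨f, ⟨-, h1, h2⟩, rfl⟩
      exact ⟨h1, h2⟩
  have hcongr : ∀ {p q : ℕ → Prop}, (∀ f < n, (p f ↔ q f)) → countLt p n = countLt q n := by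
    intro p q h
    rw [← Nat.cast_inj (R := ℕ∞), ← encard_lt_and, ← encard_lt_and]
    exact congrArg _ (Set.ext fun f => and_congr_right (h f))
  have hcount₁ : ∀ (R : Role) (e : ℕ), R.toNat ≤ c → e < n →
      {y | R.interp J (v e) y}.encard =
        (countLt (fun f => HasRel U R.toNat e f) n : ℕ∞) := by
    intro R e hRc he
    have := hcount R e Set.univ
    simp only [Set.mem_univ, and_true] at this
    rw [this, Nat.cast_inj]
    exact hcongr fun f hf => (hU R hRc e he f hf).symm
  have hcount₂ : ∀ (R : Role) (C : Concept) (e : ℕ), R.toNat ≤ c → C.toNat ≤ c → e < n →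
      {y | R.interp J (v e) y ∧ y ∈ C.interp J}.encard =
        (countLt (fun f => HasRel U R.toNat e f ∧ HasMem T C.toNat f) n : ℕ∞) := by
    intro R C e hRc hCc he
    rw [hcount, Nat.cast_inj]
    exact hcongr fun f hf => and_congr (hU R hRc e he f hf).symm (hT C hCc f hf).symm
  refine ⟨fun e he => ?_, ?_, ?_, ?_, ?_, ?_, ?_, ?_, ?_, ?_, ?_⟩
  · exact ⟨(hT .top (Nat.zero_le _) e he).2 trivial, fun hc h => (hT .bot hc e he).1 h⟩
  · intro p hp q hq e he f hf hle
    obtain ⟨R, rfl⟩ := hR p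
    obtain ⟨S, rfl⟩ := hR q
    refine (hU (.comp R S) hle e he f hf).trans ?_
    constructor
    · rintro ⟨z, h1, h2⟩
      obtain ⟨g, hg, rfl⟩ := hJ' R h1
      exact ⟨g, hg, (hU R (by omega) e he g hg).2 h1, (hU S (by omega) g hg f hf).2 h2⟩
    · rintro ⟨g, hg, h1, h2⟩
      exact ⟨v g, (hU R (by omega) e he g hg).1 h1, (hU S (by omega) g hg f hf).1 h2⟩
  · intro p hp e he hle
    obtain ⟨C, rfl⟩ := hC p
    rw [hT C (by omega) e he]
    exact hT (.not C) hle e he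
  · intro p hp q hq e he hle
    obtain ⟨C, rfl⟩ := hC p
    obtain ⟨D, rfl⟩ := hC q
    rw [hT C (by omega) e he, hT D (by omega) e he]
    exact hT (.and C D) hle e he
  · intro p hp q hq e he hle
    obtain ⟨C, rfl⟩ := hC p
    obtain ⟨D, rfl⟩ := hC q
    rw [hT C (by omega) e he, hT D (by omega) e he]
    exact hT (.or C D) hle e he
  · intro p hp q hq e he hle
    obtain ⟨R, rfl⟩ := hR p
    obtain ⟨C, rfl⟩ := hC q
    refine (hT (.all R C) hle e he).trans ⟨fun h f hf hr => ?_, fun h y hy => ?_⟩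
    · exact (hT C (by omega) f hf).2 (h _ ((hU R (by omega) e he f hf).1 hr))
    · obtain ⟨f, hf, rfl⟩ := hJ' R hy
      exact (hT C (by omega) f hf).1 (h f hf ((hU R (by omega) e he f hf).2 hy))
  · intro p hp q hq e he hle
    obtain ⟨R, rfl⟩ := hR p
    obtain ⟨C, rfl⟩ := hC q
    refine (hT (.ex R C) hle e he).trans ⟨fun ⟨y, hy, h⟩ => ?_, fun ⟨f, hf, hr, h⟩ => ?_⟩
    · obtain ⟨f, hf, rfl⟩ := hJ' R hy
      exact ⟨f, hf, (hU R (by omega) e he f hf).2 hy, (hT C (by omega) f hf).2 h⟩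
    · exact ⟨v f, (hU R (by omega) e he f hf).1 hr, (hT C (by omega) f hf).1 h⟩
  · intro m hm p hp e he hle
    obtain ⟨R, rfl⟩ := hR p
    rw [← Nat.cast_le (α := ℕ∞), ← hcount₁ R e (by omega) he]
    exact hT (.ge m R) hle e he
  · intro m hm p hp e he hle
    obtain ⟨R, rfl⟩ := hR p
    rw [← Nat.cast_le (α := ℕ∞), ← hcount₁ R e (by omega) he]
    exact hT (.le m R) hle e he
  · intro m hm p hp q hq e he hle
    obtain ⟨R, rfl⟩ := hR p
    obtain ⟨C, rfl⟩ := hC q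
    rw [← Nat.cast_le (α := ℕ∞), ← hcount₂ R C e (by omega) (by omega) he]
    exact hT (.geq m R C) hle e he
  · intro m hm p hp q hq e he hle
    obtain ⟨R, rfl⟩ := hR p
    obtain ⟨C, rfl⟩ := hC q
    rw [← Nat.cast_le (α := ℕ∞), ← hcount₂ R C e (by omega) (by omega) he]
    exact hT (.leq m R C) hle e he

theorem Concept.satisfiable_iff_hasTable (C : Concept) :
    C.Satisfiable.{u} ↔ HasTable C.toNat := by
  constructor
  · intro h
    obtain ⟨X, J, S, hS, hJ, x, hxS, hx⟩ := h.exists_small_model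
    set c := C.toNat with hc
    -- Enumerate the elements of `S`.
    obtain ⟨v, hv, hvS⟩ : ∃ v : ℕ → X, Set.InjOn v (Set.Iio S.card) ∧
        v '' Set.Iio S.card = S := by
      refine ⟨fun i => if h : i < S.card then S.equivFin.symm ⟨i, h⟩ else x, ?_, ?_⟩
      · intro i hi j hj hij
        rw [Set.mem_Iio] at hi hj
        simp only [hi, hj, dif_pos] at hij
        simpa using S.equivFin.symm.injective (Subtype.ext hij)
      · ext y
        constructor
        · rintro ⟨i, hi, rfl⟩
          rw [Set.mem_Iio] at hi
          simp [hi]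
        · intro hy
          exact ⟨S.equivFin ⟨y, hy⟩, (S.equivFin ⟨y, hy⟩).2, by simp⟩
    have hpair : ∀ p ≤ c, ∀ e < (sizeBound c + 1) ^ 2, Nat.pair p e < tableBound c := by
      intro p hp e he
      refine (Nat.pair_lt_max_add_one_sq p e).trans_le (Nat.pow_le_pow_left ?_ 2)
      have := max_le_add_of_nonneg (Nat.zero_le p) (Nat.zero_le e)
      omega
    have hlt : ∀ e < S.card, e < (sizeBound c + 1) ^ 2 := by
      intro e he
      nlinarith
    have hlt' : ∀ e < S.card, ∀ f < S.card, Nat.pair e f < (sizeBound c + 1) ^ 2 := by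
      intro e he f hf
      refine (Nat.pair_lt_max_add_one_sq e f).trans_le (Nat.pow_le_pow_left ?_ 2)
      have : max e f < S.card := max_lt he hf
      omega
    obtain ⟨T, hT, hTp⟩ := exists_bits (tableBound c) fun i =>
      v i.unpair.2 ∈ (Concept.ofNat i.unpair.1).interp J
    obtain ⟨U, hU, hUp⟩ := exists_bits (tableBound c) fun i =>
      (Role.ofNat i.unpair.1).interp J (v i.unpair.2.unpair.1) (v i.unpair.2.unpair.2)
    have hT' : ∀ D : Concept, D.toNat ≤ c → ∀ e < S.card,
        (HasMem T D.toNat e ↔ v e ∈ D.interp J) := by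
      intro D hD e he
      rw [HasMem, hTp _ (hpair _ hD _ (hlt e he)), Nat.unpair_pair, Concept.ofNat_toNat]
    refine ⟨S.card, by omega, T, hT, U, hU, isTable_of_interp hv
      (fun r x y h => hvS ▸ (hJ r x y h).2) hT' ?_, ?_⟩
    · intro R hR e he f hf
      rw [HasRel, hUp _ (hpair _ hR _ (hlt' e he f hf))]
      simp only [Nat.unpair_pair, Role.ofNat_toNat]
    · obtain ⟨e, he, rfl⟩ : x ∈ v '' Set.Iio S.card := hvS ▸ hxS
      exact ⟨e, he, (hT' C le_rfl e he).2 hx⟩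
  · rintro ⟨n, -, T, -, U, -, h, e, he, hm⟩
    exact Concept.satisfiable_of_mem (tableInterp n T U) ((h.mem_interp_iff C le_rfl he).2 hm)

theorem computablePred_satisfiable :
    ComputablePred fun C : Concept => C.Satisfiable.{u} := by
  obtain ⟨hd, hp⟩ := (primrecPred_hasTable.comp (f := fun C : Concept => C.toNat)
    Primrec.encode).of_eq fun C => (C.satisfiable_iff_hasTable).symm
  exact ⟨hd, hp.to_comp⟩

theorem computablePred_subsumedBy :
    ComputablePred fun p : Concept × Concept => p.1.SubsumedBy.{u} p.2 := by
  have hcode : Primrec fun p : Concept × Concept => (Concept.and p.1 (.not p.2)).toNat :=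
    Primrec.nat_add.comp (Primrec.nat_mul.comp (Primrec.const 10) (Primrec₂.natPair.comp
      (Primrec.encode.comp Primrec.fst) (Primrec.nat_add.comp (Primrec.nat_mul.comp
        (Primrec.const 10) (Primrec.encode.comp Primrec.snd)) (Primrec.const 3))))
      (Primrec.const 4)
  obtain ⟨hd, hp⟩ := (primrecPred_hasTable.comp hcode).not.of_eq fun p =>
    ((Concept.subsumedBy_iff p.1 p.2).trans
      (not_congr (Concept.satisfiable_iff_hasTable _))).symm
  exact ⟨hd, hp.to_comp⟩

end DL

theorem mainTheorem2 :
    -- satisfiability and subsumption are decidable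
    ComputablePred (fun C : DL.Concept => DL.Concept.Satisfiable.{u} C) ∧
    ComputablePred (fun p : DL.Concept × DL.Concept => DL.Concept.SubsumedBy.{u} p.1 p.2) ∧
    -- termination of the tableau algorithm, for every order of rule applications and all choices
    (∀ C₀ : DL.NNF, ¬ ∃ A : ℕ → DL.ABox,
      A 0 = DL.ABox.init C₀ ∧ ∀ i, DL.ABox.Step (A i) (A (i + 1))) ∧
    -- soundness, for every order of rule applications
    (∀ (C : DL.Concept) (A : DL.ABox),
      Relation.ReflTransGen DL.ABox.Step (DL.ABox.init C.nnf) A →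
      DL.ABox.Complete A → ¬ DL.ABox.Clash A → DL.Concept.Satisfiable.{u} C) ∧
    -- the answers are correct, whatever the order in which applicable rules are selected
    (∀ σ : DL.ABox → Set DL.ABox, DL.IsStrategy σ →
      (∀ C : DL.Concept, DL.Accepts σ C.nnf ↔ DL.Concept.Satisfiable.{u} C) ∧
      (∀ C D : DL.Concept,
        ¬ DL.Accepts σ (DL.Concept.and C (DL.Concept.not D)).nnf ↔
          DL.Concept.SubsumedBy.{u} C D)) := by
  refine ⟨DL.computablePred_satisfiable, DL.computablePred_subsumedBy,
    DL.not_exists_infinite_run, fun C A => DL.satisfiable_of_complete, fun σ hσ =>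
      ⟨DL.accepts_iff_satisfiable hσ, fun C D => ?_⟩⟩
  rw [DL.Concept.subsumedBy_iff, DL.accepts_iff_satisfiable hσ]
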